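/- Let $0<q<1$. Write $(a;p)_n=\prod_{i=0}^{n-1}(1-ap^i)$ for $n\in\{0,1,\dots,\infty\}$, $\mathbb R_q^+=\{q^n:n\in\mathbb Z\}$, and $\int_0^\infty f(t)\,d_qt=(1-q)\sum_{n\in\mathbb Z}q^nf(q^n)$. For $\Re(v)>-1$ let $$j_v(x,q^2)=\sum_{n\ge0}\frac{(-1)^nq^{n(n+1)}}{(q^2;q^2)_n(q^{2v+2};q^2)_n}x^{2n},\qquad c_{q,v}=\frac1{1-q}\,\frac{(q^{2v+2};q^2)_\infty}{(q^2;q^2)_\infty},$$ and for every $v\in\mathbb C$ let $$J_v(x,q^2)=\frac{x^v}{(q^2;q^2)_\infty}\sum_{n\ge0}(-1)^n\frac{q^{n(n+1)}(q^{2v+2+2n};q^2)_\infty}{(q^2;q^2)_n}x^{2n}$$ be the Hahn--Exton $q$-Bessel function, which for $\Re(v)>-1$ equals $\frac{(q^{2v+2};q^2)_\infty}{(q^2;q^2)_\infty}x^vj_v(x,q^2)$. For $m,z,k\in\mathbb Z$ put $$E_{v,x}(q^m,q^z,q^k)=\frac{q^{-k(x+2)-mv-z(x-v)}}{(1-q)^2c_{q,v}c_{q,x-v}}\,J_{z-k}(q^{x-v+m-k},q^2)\,J_{v+z-k}(q^{m-k},q^2).$$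 Let $m,z\in\mathbb Z$ and $v,x\in\mathbb C$ with $\Re(v)>-1$, $\Re(x-v)>-1$ and $\Re(x)>-1$. Then for every $\lambda\in\mathbb R_q^+$ $$j_v(q^m\lambda,q^2)\,j_{x-v}(q^z\lambda,q^2)=c_{q,x}\int_0^\infty E_{v,x}(q^m,q^z,t)\,j_x(\lambda t,q^2)\,t^{2x+1}\,d_qt,$$ and for every $k\in\mathbb Z$ $$E_{v,x}(q^m,q^z,q^k)=c_{q,x}\int_0^\infty j_v(q^m\lambda,q^2)\,j_{x-v}(q^z\lambda,q^2)\,j_x(q^k\lambda,q^2)\,\lambda^{2x+1}\,d_q\lambda,$$ where both $q$-integrals converge absolutely. For $v>-1$ let $D_v(x,y,s)=c_{q,v}^2\int_0^\infty j_v(xt,q^2)j_v(yt,q^2)j_v(st,q^2)t^{2v+1}d_qt$, let $\mathcal L_{q,1,v}$ be the space of functions $f$ on $\mathbb R_q^+$ with $\int_0^\infty|f(t)|t^{2v+1}d_qt<\infty$, let $\mathcal F_{q,v}f(x)=c_{q,v}\int_0^\infty f(t)j_v(xt,q^2)t^{2v+1}d_qt$, and define the $q$-translation $$T^v_{q,x}f(y)=c_{q,v}\int_0^\infty\mathcal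 F_{q,v}f(t)\,j_v(xt,q^2)\,j_v(yt,q^2)\,t^{2v+1}\,d_qt\qquad(x,y\in\mathbb R_q^+,\ f\in\mathcal L_{q,1,v}).$$ Let $Q_v$ be the set of $q\in\,]0,1[$ such that for all $x\in\mathbb R_q^+$ one has $T^v_{q,x}f\ge0$ on $\mathbb R_q^+$ whenever $f\in\mathcal L_{q,1,v}$ and $f\ge0$. Then for every $0<q<1$ and all $m,z,k\in\mathbb Z$ $$D_0(q^m,q^z,q^k)=\frac1{1-q}\,q^{-2k}\left[J_{z-k}(q^{m-k},q^2)\right]^2\ge0,$$ the $q$-integrals defining $T^0_{q,x}f(y)$ converge absolutely for all $f\in\mathcal L_{q,1,0}$ and $x,y\in\mathbb R_q^+$, and $Q_0=\,]0,1[$. -/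

import Mathlib

open Filter Topology

namespace HahnExton

noncomputable section

/-- The finite shifted factorial `(a; p)_n = ∏_{i < n} (1 - a p^i)`. -/
def qPoch (a : ℂ) (p : ℝ) (n : ℕ) : ℂ := ∏ i ∈ Finset.range n, (1 - a * (p : ℂ) ^ i)

/-- The infinite shifted factorial `(a; p)_∞ = ∏_{i ≥ 0} (1 - a p^i)`, for `0 < p < 1`. -/
def qPochInf (a : ℂ) (p : ℝ) : ℂ := ∏' i : ℕ, (1 - a * (p : ℂ) ^ i)

/-- The set `ℝ_q^+ = {q^n : n ∈ ℤ}`. -/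
def qReals (q : ℝ) : Set ℝ := Set.range fun n : ℤ => q ^ n

/-- The exponent `n` of a point `t = q^n` of `ℝ_q^+`. -/
def qExponent (q t : ℝ) : ℤ := ⌊Real.logb q t⌋

theorem qExponent_zpow {q : ℝ} (h0 : 0 < q) (h1 : q < 1) (n : ℤ) : qExponent q (q ^ n) = n := by
  have h : Real.log q ≠ 0 := (Real.log_neg h0 h1).ne
  have : Real.logb q (q ^ n) = (n : ℝ) := by
    rw [Real.logb, Real.log_zpow]
    field_simp
  rw [qExponent, this, Int.floor_intCast]

/-- Convergence of the Jackson `q`-integral of `f` over `[0, ∞[`. -/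
def QIntegrable {E : Type*} [NormedAddCommGroup E] [NormedSpace ℝ E] (q : ℝ) (f : ℝ → E) : Prop :=
  Summable fun n : ℤ => q ^ n • f (q ^ n)

/-- The Jackson `q`-integral `∫_0^∞ f(x) d_q x = (1 - q) ∑_{n ∈ ℤ} q^n f(q^n)`. -/
def qIntegral {E : Type*} [NormedAddCommGroup E] [NormedSpace ℝ E] (q : ℝ) (f : ℝ → E) : E :=
  (1 - q) • ∑' n : ℤ, q ^ n • f (q ^ n)

/-- The normalized Hahn-Exton `q`-Bessel function
`j_v(x, p) = ∑_n (-1)^n p^{n(n+1)/2} / ((p; p)_n (p^{v+1}; p)_n) x^{2n}`. -/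
def jNorm (p : ℝ) (v x : ℂ) : ℂ :=
  ∑' n : ℕ, (-1) ^ n * (p : ℂ) ^ (n * (n + 1) / 2) /
    (qPoch p p n * qPoch ((p : ℂ) ^ (v + 1)) p n) * x ^ (2 * n)

/-- The Hahn-Exton `q`-Bessel function of order `v`,
`J_v(x, p) = (p^{v+1}; p)_∞ / (p; p)_∞ x^v ₁φ₁(0; p^{v+1}; p, p x^2)`.
The factor `(p^{v+1}; p)_∞` is multiplied into the series by
`(p^{v+1}; p)_∞ / (p^{v+1}; p)_n = (p^{v+1+n}; p)_∞`, so that the definition makes sense for every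
complex order `v`, in particular for the negative integers. -/
def besselJ (p : ℝ) (v x : ℂ) : ℂ :=
  x ^ v / qPochInf p p *
    ∑' n : ℕ, (-1) ^ n * (p : ℂ) ^ (n * (n + 1) / 2) * qPochInf ((p : ℂ) ^ (v + 1 + n)) p /
      qPoch p p n * x ^ (2 * n)

theorem multipliable_qPoch {p : ℝ} (h0 : 0 < p) (h1 : p < 1) (a : ℂ) :
    Multipliable fun i : ℕ => (1 - a * (p : ℂ) ^ i) := by
  have : Summable fun i : ℕ => ‖-(a * (p : ℂ) ^ i)‖ := by
    have hp : ‖(p : ℂ)‖ < 1 := by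
      rw [Complex.norm_real, Real.norm_of_nonneg h0.le]
      exact h1
    simpa using (summable_geometric_of_lt_one (norm_nonneg _) hp).mul_left ‖a‖
  simpa [sub_eq_add_neg] using multipliable_one_add_of_summable this

theorem qPoch_mul_qPochInf {p : ℝ} (h0 : 0 < p) (h1 : p < 1) (w : ℂ) (n : ℕ) :
    qPoch ((p : ℂ) ^ w) p n * qPochInf ((p : ℂ) ^ (w + n)) p = qPochInf ((p : ℂ) ^ w) p := by
  have hp : (p : ℂ) ≠ 0 := by exact_mod_cast h0.ne'
  have e : ∀ i : ℕ, 1 - (p : ℂ) ^ (w + n) * (p : ℂ) ^ i =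
      1 - (p : ℂ) ^ w * (p : ℂ) ^ (i + n) := by
    intro i
    rw [Complex.cpow_add _ _ hp, Complex.cpow_natCast]
    ring
  have hm := multipliable_qPoch h0 h1 ((p : ℂ) ^ (w + n))
  simp only [e] at hm
  unfold qPoch qPochInf
  simp only [e]
  exact Multipliable.prod_mul_tprod_nat_mul'
    (f := fun i : ℕ => 1 - (p : ℂ) ^ w * (p : ℂ) ^ i) hm

theorem qPoch_ne_zero {p : ℝ} (h0 : 0 < p) (h1 : p < 1) {w : ℂ} (hw : 0 < w.re) (n : ℕ) :
    qPoch ((p : ℂ) ^ w) p n ≠ 0 := by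
  unfold qPoch
  refine Finset.prod_ne_zero_iff.mpr fun i _ h => ?_
  have h2 : ‖(p : ℂ) ^ w * (p : ℂ) ^ i‖ < 1 := by
    rw [norm_mul, norm_pow, Complex.norm_cpow_eq_rpow_re_of_pos h0, Complex.norm_real,
      Real.norm_of_nonneg h0.le]
    exact mul_lt_one_of_nonneg_of_lt_one_left (by positivity)
      (Real.rpow_lt_one h0.le h1 hw) (pow_le_one₀ h0.le h1.le)
  rw [← sub_eq_zero.mp h] at h2
  simp at h2

/-- For `Re v > -1` the definition of `J_v` is the usual one,
`J_v(x, p) = (p^{v+1}; p)_∞ / (p; p)_∞ x^v j_v(x, p)`. -/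
theorem besselJ_eq {p : ℝ} (h0 : 0 < p) (h1 : p < 1) {v : ℂ} (hv : -1 < v.re) (x : ℂ) :
    besselJ p v x =
      qPochInf ((p : ℂ) ^ (v + 1)) p / qPochInf p p * x ^ v * jNorm p v x := by
  have hw : 0 < (v + 1).re := by
    simp only [Complex.add_re, Complex.one_re]
    linarith
  unfold besselJ jNorm
  rw [show qPochInf ((p : ℂ) ^ (v + 1)) p / qPochInf p p * x ^ v =
    x ^ v / qPochInf p p * qPochInf ((p : ℂ) ^ (v + 1)) p by ring, mul_assoc]
  congr 1
  rw [← tsum_mul_left (a := qPochInf ((p : ℂ) ^ (v + 1)) p)]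
  refine tsum_congr (fun n => ?_)
  have hne := qPoch_ne_zero h0 h1 hw n
  rw [← qPoch_mul_qPochInf h0 h1 (v + 1) n, div_mul_eq_div_div]
  field_simp

/-- The constant `c_{q,v} = (1 - q)⁻¹ (q^{2v+2}; q²)_∞ / (q²; q²)_∞`. -/
def cConst (q : ℝ) (v : ℂ) : ℂ :=
  1 / (1 - (q : ℂ)) * (qPochInf ((q : ℂ) ^ (2 * v + 2)) (q ^ 2) / qPochInf ((q : ℂ) ^ 2) (q ^ 2))

/-- The `q`-Bessel transform of order `v`,
`F_{q,v} f(x) = c_{q,v} ∫_0^∞ f(t) j_v(xt, q²) t^{2v+1} d_q t`. -/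
def besselTransform (q : ℝ) (v : ℂ) (f : ℝ → ℂ) (x : ℝ) : ℂ :=
  cConst q v * qIntegral q fun t => f t * jNorm (q ^ 2) v ((x * t : ℝ) : ℂ) * (t : ℂ) ^ (2 * v + 1)

/-- The space `L_{q,1,v}`: functions with `∫_0^∞ |f(x)| x^{2v+1} d_q x < ∞`. -/
def MemLOne (q v : ℝ) (f : ℝ → ℂ) : Prop :=
  QIntegrable q fun x => ‖f x‖ * x ^ (2 * v + 1)

/-- The `q`-translation operator `T_{q,x}^v f(y) =
c_{q,v} ∫_0^∞ F_{q,v}(f)(t) j_v(xt, q²) j_v(yt, q²) t^{2v+1} d_q t`. -/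
def translation (q : ℝ) (v : ℂ) (x : ℝ) (f : ℝ → ℂ) (y : ℝ) : ℂ :=
  cConst q v * qIntegral q fun t =>
    besselTransform q v f t * jNorm (q ^ 2) v ((x * t : ℝ) : ℂ) *
      jNorm (q ^ 2) v ((y * t : ℝ) : ℂ) * (t : ℂ) ^ (2 * v + 1)

/-- `T_{q,x}^v` is positive: `T_{q,x}^v f ≥ 0` on `ℝ_q^+` for each `f ∈ L_{q,1,v}` that is
nonnegative on `ℝ_q^+`. -/
def TranslationPositive (q v x : ℝ) : Prop :=
  ∀ f : ℝ → ℝ, MemLOne q v (fun t => (f t : ℂ)) → (∀ t ∈ qReals q, 0 ≤ f t) →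
    ∀ y ∈ qReals q, (translation q v x (fun t => (f t : ℂ)) y).im = 0 ∧
      0 ≤ (translation q v x (fun t => (f t : ℂ)) y).re

/-- The domain of positivity
`Q_v = {q ∈ ]0,1[ : T_{q,x}^v is positive for all x ∈ ℝ_q^+}`. -/
def positivityDomain (v : ℝ) : Set ℝ :=
  {q | q ∈ Set.Ioo (0 : ℝ) 1 ∧ ∀ x ∈ qReals q, TranslationPositive q v x}

/-- The kernel `D_v(x, y, z) =
c_{q,v}² ∫_0^∞ j_v(xt, q²) j_v(yt, q²) j_v(zt, q²) t^{2v+1} d_q t`. -/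
def kernelD (q : ℝ) (v : ℂ) (x y z : ℝ) : ℂ :=
  cConst q v ^ 2 * qIntegral q fun t =>
    jNorm (q ^ 2) v ((x * t : ℝ) : ℂ) * jNorm (q ^ 2) v ((y * t : ℝ) : ℂ) *
      jNorm (q ^ 2) v ((z * t : ℝ) : ℂ) * (t : ℂ) ^ (2 * v + 1)

/-- The value `E_{v,x}(q^m, q^z, q^k)` of the product kernel, in terms of the exponents. -/
def kernelEExp (q : ℝ) (v x : ℂ) (m z k : ℤ) : ℂ :=
  1 / ((1 - (q : ℂ)) ^ 2 * cConst q v * cConst q (x - v)) *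
    (q : ℂ) ^ (-(k : ℂ) * (x + 2) - m * v - z * (x - v)) *
    besselJ (q ^ 2) ((z : ℂ) - k) ((q : ℂ) ^ (x - v + m - k)) *
    besselJ (q ^ 2) (v + z - k) ((q : ℂ) ^ (m - k))

/-- The product kernel `E_{v,x}(a, b, t)` for `a, b, t ∈ ℝ_q^+`. -/
def kernelE (q : ℝ) (v x : ℂ) (a b t : ℝ) : ℂ :=
  kernelEExp q v x (qExponent q a) (qExponent q b) (qExponent q t)

theorem kernelE_zpow {q : ℝ} (h0 : 0 < q) (h1 : q < 1) (v x : ℂ) (m z k : ℤ) :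
    kernelE q v x (q ^ m) (q ^ z) (q ^ k) =
      1 / ((1 - (q : ℂ)) ^ 2 * cConst q v * cConst q (x - v)) *
        (q : ℂ) ^ (-(k : ℂ) * (x + 2) - m * v - z * (x - v)) *
        besselJ (q ^ 2) ((z : ℂ) - k) ((q : ℂ) ^ (x - v + m - k)) *
        besselJ (q ^ 2) (v + z - k) ((q : ℂ) ^ (m - k)) := by
  simp only [kernelE, qExponent_zpow h0 h1, kernelEExp]

end

end HahnExton

/-! Everything is a comparison of Laurent coefficients. Put p = q², a = q^v and b = q^(x-v), so that
ab = q^x. The symmetry J_v(q^m) = J_m(q^v) (`besselJ_zpow`) turns the Bessel functions of complex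
order at points of the lattice into functions of integer order at a, b and ab (`besselZ`), and the
kernel E into the product K(i, j) = J_i(a q^j) J_j(b q^i) (`pairK`), up to explicit powers.

For integer order there is a generating function, Σ_n J_n(x) s^n = G_x(s) = (p x/s; p)_∞ / (x s;
p)_∞ (`hasSum_generating`). The double series of K is also a product: Σ K(i, j) s^i t^j = G_a(s)
G_b(t) / G_{ab}(st) (`hasSum_product_generating`). It splits into two double sums, each evaluated by
Euler's expansions and the q-binomial theorem. Since 1/G_{ab}(u) = G_{ab}(p/u), the relations G_a
G_b = K·G_{ab} and K = G_a G_b / G_{ab} are both multiplications of Laurent series on a common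
torus. Their coefficients give the product formula and its inverse (`product_formulas`). Such a
torus exists because |ab| < 1/q, which is Re x > -1.

For order zero a = b = 1, and the symmetry makes the two factors of K equal, so K is the square of a
real number (`pairK_one_one`). Fubini writes the translation as Σ_k f(q^k) K(i-k, l-k), which is
nonnegative when f is. -/

namespace HahnExton

/-! ### Shifted factorials, the q-binomial theorem and Euler's expansion. -/

section QSeries

variable {p : ℝ}

theorem norm_ofReal_lt_one (h0 : 0 < p) (h1 : p < 1) : ‖(p : ℂ)‖ < 1 := by
  rwa [Complex.norm_real, Real.norm_of_nonneg h0.le]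

theorem ofReal_ne_zero_of_pos (h0 : 0 < p) : (p : ℂ) ≠ 0 := by exact_mod_cast h0.ne'

theorem qPoch_zero (a : ℂ) : qPoch a p 0 = 1 := by simp [qPoch]

theorem qPoch_succ (a : ℂ) (n : ℕ) : qPoch a p (n + 1) = qPoch a p n * (1 - a * (p : ℂ) ^ n) := by
  simp [qPoch, Finset.prod_range_succ]

theorem qPoch_mul_qPochInf_shift (h0 : 0 < p) (h1 : p < 1) (a : ℂ) (n : ℕ) :
    qPoch a p n * qPochInf (a * (p : ℂ) ^ n) p = qPochInf a p := by
  have e : ∀ i : ℕ, 1 - a * (p : ℂ) ^ n * (p : ℂ) ^ i = 1 - a * (p : ℂ) ^ (i + n) := by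
    intro i
    ring
  have hm := multipliable_qPoch h0 h1 (a * (p : ℂ) ^ n)
  simp only [e] at hm
  unfold qPoch qPochInf
  simp only [e]
  exact Multipliable.prod_mul_tprod_nat_mul' (f := fun i : ℕ => 1 - a * (p : ℂ) ^ i) hm

theorem qPochInf_eq_mul (h0 : 0 < p) (h1 : p < 1) (a : ℂ) :
    qPochInf a p = (1 - a) * qPochInf (a * p) p := by
  rw [← qPoch_mul_qPochInf_shift h0 h1 a 1]
  simp [qPoch]

theorem qPochInf_zero : qPochInf 0 p = 1 := by simp [qPochInf]

theorem qPochInf_one (h0 : 0 < p) (h1 : p < 1) : qPochInf 1 p = 0 := by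
  rw [qPochInf_eq_mul h0 h1]
  simp

theorem tendsto_qPoch (h0 : 0 < p) (h1 : p < 1) (a : ℂ) :
    Tendsto (fun n => qPoch a p n) atTop (𝓝 (qPochInf a p)) :=
  (multipliable_qPoch h0 h1 a).tendsto_prod_tprod_nat

theorem qPochInf_ne_zero (h0 : 0 < p) (h1 : p < 1) {a : ℂ} (ha : ‖a‖ < 1) :
    qPochInf a p ≠ 0 := by
  have hp := norm_ofReal_lt_one h0 h1
  have := tprod_one_add_ne_zero_of_summable (f := fun i : ℕ => -(a * (p : ℂ) ^ i)) ?_ ?_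
  · simpa [qPochInf, sub_eq_add_neg] using this
  · intro i h
    have h2 : ‖a * (p : ℂ) ^ i‖ < 1 := by
      rw [norm_mul, norm_pow]
      exact mul_lt_one_of_nonneg_of_lt_one_left (norm_nonneg _) ha
        (pow_le_one₀ (norm_nonneg _) hp.le)
    rw [← sub_eq_add_neg, sub_eq_zero] at h
    rw [← h] at h2
    simp at h2
  · simpa using (summable_geometric_of_lt_one (norm_nonneg _) hp).mul_left ‖a‖

theorem qPoch_ne_zero_of_norm_lt (h0 : 0 < p) (h1 : p < 1) {a : ℂ} (ha : ‖a‖ < 1) (n : ℕ) :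
    qPoch a p n ≠ 0 := by
  intro h
  apply qPochInf_ne_zero h0 h1 ha
  rw [← qPoch_mul_qPochInf_shift h0 h1 a n, h, zero_mul]

theorem qPoch_self_ne_zero (h0 : 0 < p) (h1 : p < 1) (n : ℕ) : qPoch p p n ≠ 0 :=
  qPoch_ne_zero_of_norm_lt h0 h1 (norm_ofReal_lt_one h0 h1) n

theorem exists_norm_qPoch_le (h0 : 0 < p) (h1 : p < 1) (a : ℂ) :
    ∃ C : ℝ, 0 < C ∧ ∀ n, ‖qPoch a p n‖ ≤ C := by
  obtain ⟨C, hC, h⟩ := (Metric.isBounded_range_of_tendsto _ (tendsto_qPoch h0 h1 a)).exists_pos_norm_le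
  exact ⟨C, hC, fun n => h _ ⟨n, rfl⟩⟩

theorem exists_norm_inv_qPoch_le (h0 : 0 < p) (h1 : p < 1) :
    ∃ C : ℝ, 0 < C ∧ ∀ n, ‖(qPoch p p n)⁻¹‖ ≤ C := by
  have := (tendsto_qPoch h0 h1 p).inv₀ (qPochInf_ne_zero h0 h1 (norm_ofReal_lt_one h0 h1))
  obtain ⟨C, hC, h⟩ := (Metric.isBounded_range_of_tendsto _ this).exists_pos_norm_le
  exact ⟨C, hC, fun n => h _ ⟨n, rfl⟩⟩

theorem triangle_succ (n : ℕ) : (n + 1) * (n + 1 + 1) / 2 = n * (n + 1) / 2 + (n + 1) := by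
  rw [show (n + 1) * (n + 1 + 1) = n * (n + 1) + 2 * (n + 1) by ring,
    Nat.add_mul_div_left _ _ two_pos]

/-- A power series that converges at `x` tends to its constant term along `x p^k`, `k → ∞`. -/
theorem tendsto_tsum_mul_geometric (h0 : 0 < p) (h1 : p < 1) {a : ℕ → ℂ} {x : ℂ}
    (hx : Summable fun n => a n * x ^ n) :
    Tendsto (fun k : ℕ => ∑' n, a n * (x * (p : ℂ) ^ k) ^ n) atTop (𝓝 (a 0)) := by
  have hp := norm_ofReal_lt_one h0 h1
  have : Tendsto (fun k : ℕ => ∑' n, a n * (x * (p : ℂ) ^ k) ^ n) atTop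
      (𝓝 (∑' n, if n = 0 then a 0 else 0)) := by
    refine tendsto_tsum_of_dominated_convergence (bound := fun n => ‖a n * x ^ n‖) hx.norm ?_ ?_
    · intro n
      rcases n with _ | n
      · simp
      · simp only [Nat.add_eq_zero_iff, one_ne_zero, and_false, if_false]
        have : Tendsto (fun k : ℕ => a (n + 1) * (x * (p : ℂ) ^ k) ^ (n + 1)) atTop
            (𝓝 (a (n + 1) * (x * 0) ^ (n + 1))) :=
          (((tendsto_pow_atTop_nhds_zero_of_norm_lt_one hp).const_mul x).pow _).const_mul _
        simpa using this
    · refine Eventually.of_forall fun k n => ?_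
      rw [mul_pow, ← mul_assoc, norm_mul (a n * x ^ n)]
      refine mul_le_of_le_one_right (norm_nonneg _) ?_
      rw [norm_pow, norm_pow]
      exact pow_le_one₀ (by positivity) (pow_le_one₀ (norm_nonneg _) hp.le)
  simpa using this

theorem inv_qPoch_succ_mul (h0 : 0 < p) (h1 : p < 1) (n : ℕ) :
    (qPoch p p (n + 1))⁻¹ * (1 - (p : ℂ) ^ (n + 1)) = (qPoch p p n)⁻¹ := by
  have h := qPoch_self_ne_zero h0 h1 (n + 1)
  have e := qPoch_succ p (p := p) n
  rw [← pow_succ'] at e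
  rw [e] at h ⊢
  rw [mul_inv, mul_assoc, inv_mul_cancel₀ (right_ne_zero_of_mul h), mul_one]

/-- The `q`-binomial theorem. -/
theorem hasSum_qBinomial (h0 : 0 < p) (h1 : p < 1) (X : ℂ) {Y : ℂ} (hY : ‖Y‖ < 1) :
    HasSum (fun n => qPoch X p n / qPoch p p n * Y ^ n) (qPochInf (X * Y) p / qPochInf Y p) := by
  have hp := norm_ofReal_lt_one h0 h1
  obtain ⟨C, hC, hC'⟩ := exists_norm_qPoch_le h0 h1 X
  obtain ⟨D, hD, hD'⟩ := exists_norm_inv_qPoch_le h0 h1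
  have hsum : ∀ {y : ℂ}, ‖y‖ < 1 → Summable fun n => qPoch X p n / qPoch p p n * y ^ n := by
    intro y hy
    refine Summable.of_norm_bounded
      ((summable_geometric_of_lt_one (norm_nonneg _) hy).mul_left (C * D)) fun n => ?_
    rw [norm_mul, norm_pow, div_eq_mul_inv, norm_mul]
    gcongr
    · exact hC' n
    · exact hD' n
  set f : ℂ → ℂ := fun y => ∑' n, qPoch X p n / qPoch p p n * y ^ n with hf
  -- The q-difference equation of the series; iterating it pushes the argument to 0, where the
  -- series equals 1.
  have hfun : ∀ {y : ℂ}, ‖y‖ < 1 → (1 - y) * f y = (1 - X * y) * f (y * p) := by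
    intro y hy
    have hyp : ‖y * p‖ < 1 := by
      rw [norm_mul]
      exact mul_lt_one_of_nonneg_of_lt_one_left (norm_nonneg _) hy hp.le
    have s1 := hsum hy
    have s2 := hsum hyp
    have e1 : f y - f (y * p) =
        ∑' n, qPoch X p n / qPoch p p n * (1 - X * p ^ n) * y ^ (n + 1) := by
      rw [hf, ← s1.tsum_sub s2, (s1.sub s2).tsum_eq_zero_add]
      simp only [pow_zero, mul_one, sub_self, zero_add]
      refine tsum_congr fun n => ?_
      have h := inv_qPoch_succ_mul h0 h1 n
      rw [div_eq_mul_inv, div_eq_mul_inv, qPoch_succ X, mul_pow]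
      linear_combination qPoch X p n * (1 - X * p ^ n) * y ^ (n + 1) * h
    have e2 : y * f y - X * y * f (y * p) =
        ∑' n, qPoch X p n / qPoch p p n * (1 - X * p ^ n) * y ^ (n + 1) := by
      rw [hf, ← tsum_mul_left, ← tsum_mul_left, ← (s1.mul_left y).tsum_sub (s2.mul_left (X * y))]
      refine tsum_congr fun n => ?_
      ring
    linear_combination e1 - e2
  have hiter : ∀ k : ℕ, qPoch Y p k * f Y = qPoch (X * Y) p k * f (Y * p ^ k) := by
    intro k
    induction k with
    | zero => simp [qPoch_zero]
    | succ k ih =>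
      have hyk : ‖Y * (p : ℂ) ^ k‖ < 1 := by
        rw [norm_mul, norm_pow]
        exact mul_lt_one_of_nonneg_of_lt_one_left (norm_nonneg _) hY
          (pow_le_one₀ (norm_nonneg _) hp.le)
      have := hfun hyk
      rw [qPoch_succ, qPoch_succ, pow_succ, ← mul_assoc Y]
      linear_combination (1 - Y * p ^ k) * ih + qPoch (X * Y) p k * this
  have hlim := tendsto_tsum_mul_geometric h0 h1 (hsum hY)
  have l1 := (tendsto_qPoch h0 h1 Y).mul_const (f Y)
  have l2 := (tendsto_qPoch h0 h1 (X * Y)).mul hlim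
  have := tendsto_nhds_unique (l1.congr hiter) l2
  rw [qPoch_zero, qPoch_zero, div_one, mul_one] at this
  rw [← this, mul_div_cancel_left₀ _ (qPochInf_ne_zero h0 h1 hY)]
  exact (hsum hY).hasSum

theorem hasSum_inv_qPochInf (h0 : 0 < p) (h1 : p < 1) {Y : ℂ} (hY : ‖Y‖ < 1) :
    HasSum (fun n => (qPoch p p n)⁻¹ * Y ^ n) (qPochInf Y p)⁻¹ := by
  simpa [qPoch, qPochInf_zero] using hasSum_qBinomial h0 h1 0 hY

theorem summable_triangle (h0 : 0 < p) (h1 : p < 1) (x : ℂ) :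
    Summable fun n : ℕ => (p : ℂ) ^ (n * (n + 1) / 2) * x ^ n := by
  have hp := norm_ofReal_lt_one h0 h1
  by_cases hx : x = 0
  · subst hx
    refine summable_of_ne_finset_zero (s := {0}) fun n hn => ?_
    simp at hn
    simp [hn]
  refine summable_of_ratio_test_tendsto_lt_one (l := 0) one_pos
    (Eventually.of_forall fun n => ?_) ?_
  · exact mul_ne_zero (pow_ne_zero _ (ofReal_ne_zero_of_pos h0)) (pow_ne_zero _ hx)
  · have : Tendsto (fun n : ℕ => ‖(p : ℂ)‖ ^ (n + 1) * ‖x‖) atTop (𝓝 (0 * ‖x‖)) :=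
      ((tendsto_add_atTop_iff_nat 1).2
        (tendsto_pow_atTop_nhds_zero_of_lt_one (norm_nonneg _) hp)).mul_const _
    rw [zero_mul] at this
    refine this.congr fun n => ?_
    have hx' : ‖x‖ ≠ 0 := norm_ne_zero_iff.2 hx
    have hp' : ‖(p : ℂ)‖ ≠ 0 := norm_ne_zero_iff.2 (ofReal_ne_zero_of_pos h0)
    rw [triangle_succ]
    simp only [norm_mul, norm_pow, pow_add, pow_one]
    field_simp

theorem exists_triangle_le (h0 : 0 < p) (h1 : p < 1) (x : ℝ) :
    ∃ C : ℝ, 0 < C ∧ ∀ n : ℕ, p ^ (n * (n + 1) / 2) * |x| ^ n ≤ C := by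
  obtain ⟨C, hC, h⟩ := (Metric.isBounded_range_of_tendsto _
    (summable_triangle h0 h1 x).tendsto_atTop_zero).exists_pos_norm_le
  refine ⟨C, hC, fun n => ?_⟩
  simpa [abs_of_pos h0] using h _ ⟨n, rfl⟩

/-- Euler's expansion of `(p x; p)_∞`. -/
theorem hasSum_qPochInf (h0 : 0 < p) (h1 : p < 1) (x : ℂ) :
    HasSum (fun n : ℕ => (-1) ^ n * (p : ℂ) ^ (n * (n + 1) / 2) * (qPoch p p n)⁻¹ * x ^ n)
      (qPochInf (p * x) p) := by
  obtain ⟨D, hD, hD'⟩ := exists_norm_inv_qPoch_le h0 h1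
  have hsum : ∀ y : ℂ, Summable fun n : ℕ =>
      (-1) ^ n * (p : ℂ) ^ (n * (n + 1) / 2) * (qPoch p p n)⁻¹ * y ^ n := by
    intro y
    refine Summable.of_norm_bounded ((summable_triangle h0 h1 y).norm.mul_left D) fun n => ?_
    rw [norm_mul, norm_mul, norm_mul, norm_pow, norm_neg, norm_one, one_pow, one_mul, norm_mul,
      mul_comm _ ‖(qPoch p p n)⁻¹‖, mul_assoc]
    gcongr
    exact hD' n
  set f : ℂ → ℂ := fun y => ∑' n : ℕ,
    (-1) ^ n * (p : ℂ) ^ (n * (n + 1) / 2) * (qPoch p p n)⁻¹ * y ^ n with hf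
  have hfun : ∀ y : ℂ, f y = (1 - p * y) * f (y * p) := by
    intro y
    have s1 := hsum y
    have s2 := hsum (y * p)
    have e1 : f y - f (y * p) = - (p * y) * f (y * p) := by
      rw [hf, ← s1.tsum_sub s2, (s1.sub s2).tsum_eq_zero_add, ← tsum_mul_left]
      simp only [pow_zero, mul_one, sub_self, zero_add]
      refine tsum_congr fun n => ?_
      have h := inv_qPoch_succ_mul h0 h1 n
      rw [triangle_succ, pow_add, mul_pow, mul_pow]
      linear_combination
        (-1) ^ (n + 1) * (p : ℂ) ^ (n * (n + 1) / 2) * p ^ (n + 1) * y ^ (n + 1) * h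
    linear_combination e1
  have hiter : ∀ k : ℕ, f x = qPoch (p * x) p k * f (x * p ^ k) := by
    intro k
    induction k with
    | zero => simp [qPoch_zero]
    | succ k ih =>
      have := hfun (x * p ^ k)
      rw [ih, qPoch_succ, pow_succ, ← mul_assoc x]
      linear_combination qPoch (p * x) p k * this
  have hlim := tendsto_tsum_mul_geometric h0 h1 (hsum x)
  have l2 := (tendsto_qPoch h0 h1 (p * x)).mul hlim
  have := tendsto_nhds_unique (tendsto_const_nhds.congr hiter) l2
  simp only [qPoch_zero, inv_one, pow_zero, Nat.zero_div, zero_mul, mul_one] at this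
  rw [← this]
  exact (hsum x).hasSum

end QSeries

/-! ### Hahn-Exton functions of integer order and their symmetry. -/

section IntegerOrder

variable {p : ℝ}

/-- The reciprocal `1 / (p; p)_n`, extended by zero to negative `n`. -/
noncomputable def invFact (p : ℝ) (n : ℤ) : ℂ := if 0 ≤ n then (qPoch p p n.toNat)⁻¹ else 0

theorem invFact_natCast (n : ℕ) : invFact p n = (qPoch p p n)⁻¹ := by simp [invFact]

theorem invFact_of_neg {n : ℤ} (hn : n < 0) : invFact p n = 0 := by simp [invFact, hn]

/-- The terms of the series of the Hahn-Exton function of integer order. -/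
noncomputable def besselTerm (p : ℝ) (n : ℤ) (x : ℂ) (l : ℕ) : ℂ :=
  (-1) ^ l * (p : ℂ) ^ (l * (l + 1) / 2) * (qPoch p p l)⁻¹ * invFact p (n + l) *
    x ^ (n + 2 * l : ℤ)

/-- The Hahn-Exton function of integer order. -/
noncomputable def besselZ (p : ℝ) (n : ℤ) (x : ℂ) : ℂ := ∑' l, besselTerm p n x l

theorem exists_norm_invFact_le (h0 : 0 < p) (h1 : p < 1) :
    ∃ C : ℝ, 0 < C ∧ ∀ n, ‖invFact p n‖ ≤ C := by
  obtain ⟨C, hC, h⟩ := exists_norm_inv_qPoch_le h0 h1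
  refine ⟨C, hC, fun n => ?_⟩
  unfold invFact
  split_ifs
  · exact h _
  · simpa using hC.le

theorem summable_besselTerm (h0 : 0 < p) (h1 : p < 1) (n : ℤ) {x : ℂ} (hx : x ≠ 0) :
    Summable (besselTerm p n x) := by
  obtain ⟨C, hC, h⟩ := exists_norm_invFact_le h0 h1
  refine Summable.of_norm_bounded
    ((summable_triangle h0 h1 (x ^ 2)).norm.mul_left (C * C * ‖x ^ n‖)) fun l => ?_
  have e : besselTerm p n x l = (-1) ^ l * ((qPoch p p l)⁻¹ * invFact p (n + l) * x ^ n *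
      ((p : ℂ) ^ (l * (l + 1) / 2) * (x ^ 2) ^ l)) := by
    unfold besselTerm
    rw [zpow_add₀ hx, zpow_mul, zpow_natCast, zpow_ofNat]
    ring
  rw [e, norm_mul, norm_pow, norm_neg, norm_one, one_pow, one_mul, norm_mul, norm_mul _ (x ^ n),
    norm_mul (qPoch p p l)⁻¹]
  gcongr
  · rw [← invFact_natCast]
    exact h _
  · exact h _

theorem hasSum_besselZ (h0 : 0 < p) (h1 : p < 1) (n : ℤ) {x : ℂ} (hx : x ≠ 0) :
    HasSum (besselTerm p n x) (besselZ p n x) :=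
  (summable_besselTerm h0 h1 n hx).hasSum

/-- For negative n one factor of the infinite product is 1 - p^0 = 0. This is why the extension of
1/(p; p)_n by zero is the right one. -/
theorem qPochInf_zpow (h0 : 0 < p) (h1 : p < 1) (n : ℤ) :
    qPochInf (p * (p : ℂ) ^ n) p = qPochInf p p * invFact p n := by
  have hp := ofReal_ne_zero_of_pos h0
  rcases le_or_gt 0 n with hn | hn
  · lift n to ℕ using hn
    rw [invFact_natCast, zpow_natCast, ← qPoch_mul_qPochInf_shift h0 h1 p n]
    rw [mul_right_comm, mul_inv_cancel₀ (qPoch_self_ne_zero h0 h1 n), one_mul]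
  · rw [invFact_of_neg hn, mul_zero]
    obtain ⟨k, rfl⟩ : ∃ k : ℕ, n = -1 - k := ⟨(-1 - n).toNat, by omega⟩
    have e : (p : ℂ) * p ^ (-1 - k : ℤ) * p ^ k = 1 := by
      rw [← zpow_natCast (p : ℂ) k, ← zpow_one_add₀ hp, ← zpow_add₀ hp, ← zpow_zero (p : ℂ)]
      congr 1
      ring
    rw [← qPoch_mul_qPochInf_shift h0 h1 _ k, e, qPochInf_one h0 h1, mul_zero]

/-- The function `(p w; p)_∞ ₁φ₁(0; p w; p, p z)` is symmetric in `w` and `z`. -/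
theorem tsum_qPochInf_symm (h0 : 0 < p) (h1 : p < 1) (w z : ℂ) :
    ∑' l : ℕ, (-1) ^ l * (p : ℂ) ^ (l * (l + 1) / 2) * (qPoch p p l)⁻¹ *
        qPochInf (p * (w * p ^ l)) p * z ^ l =
      ∑' l : ℕ, (-1) ^ l * (p : ℂ) ^ (l * (l + 1) / 2) * (qPoch p p l)⁻¹ *
        qPochInf (p * (z * p ^ l)) p * w ^ l := by
  have hp := norm_ofReal_lt_one h0 h1
  set f : ℂ → ℕ → ℂ :=
    fun x n => (-1) ^ n * (p : ℂ) ^ (n * (n + 1) / 2) * (qPoch p p n)⁻¹ * x ^ n with hf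
  have hsum : Summable fun x : ℕ × ℕ => f z x.1 * f w x.2 * p ^ (x.1 * x.2) := by
    have h := summable_mul_of_summable_norm (hasSum_qPochInf h0 h1 z).summable.norm
      (hasSum_qPochInf h0 h1 w).summable.norm
    refine Summable.of_norm_bounded h.norm fun x => ?_
    rw [norm_mul]
    refine mul_le_of_le_one_right (norm_nonneg _) ?_
    rw [norm_pow]
    exact pow_le_one₀ (norm_nonneg _) hp.le
  -- Euler's expansion of the infinite factor yields a double series whose coupling p^(lk) is
  -- symmetric, so exchanging the sums exchanges w and z.
  have e := hsum.tsum_comm (f := fun l k => f z l * f w k * p ^ (l * k))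
  have e1 : ∀ x y : ℂ, ∀ l : ℕ, (-1) ^ l * (p : ℂ) ^ (l * (l + 1) / 2) * (qPoch p p l)⁻¹ *
        qPochInf (p * (x * p ^ l)) p * y ^ l = ∑' k, f y l * f x k * p ^ (l * k) := by
    intro x y l
    rw [← (hasSum_qPochInf h0 h1 (x * p ^ l)).tsum_eq, ← tsum_mul_left, ← tsum_mul_right]
    refine tsum_congr fun k => ?_
    simp only [hf, mul_pow, pow_mul]
    ring
  simp only [e1]
  rw [← e]
  refine tsum_congr fun l => tsum_congr fun k => ?_
  rw [mul_comm k l]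
  ring

theorem besselJ_intCast (h0 : 0 < p) (h1 : p < 1) (n : ℤ) {x : ℂ} (hx : x ≠ 0) :
    besselJ p n x = besselZ p n x := by
  have hp := ofReal_ne_zero_of_pos h0
  have hne := qPochInf_ne_zero h0 h1 (norm_ofReal_lt_one h0 h1)
  unfold besselJ besselZ
  rw [← tsum_mul_left]
  refine tsum_congr fun l => ?_
  have e : (p : ℂ) ^ ((n : ℂ) + 1 + l) = p * (p : ℂ) ^ (n + l : ℤ) := by
    rw [← zpow_one_add₀ hp, ← Complex.cpow_intCast]
    congr 1
    push_cast
    ring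
  rw [e, qPochInf_zpow h0 h1, Complex.cpow_intCast, besselTerm, zpow_add₀ hx, zpow_mul,
    zpow_natCast, zpow_ofNat, pow_mul]
  field_simp

/-- The logarithm of q is real, so no branch of the complex power interferes. -/
theorem zpow_cpow {q : ℝ} (h0 : 0 < q) (n : ℤ) (v : ℂ) : ((q : ℂ) ^ n) ^ v = ((q : ℂ) ^ v) ^ n := by
  have hlog : (Complex.log q).im = 0 := by
    rw [← Complex.ofReal_log h0.le, Complex.ofReal_im]
  rw [← Complex.cpow_mul_int, mul_comm v, Complex.cpow_mul, Complex.cpow_intCast]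
  · simp [hlog, Real.pi_pos]
  · simp [hlog, Real.pi_pos.le]

/-- The symmetry `J_v(q^m; q²) = J_m(q^v; q²)`. -/
theorem besselJ_zpow {q : ℝ} (h0 : 0 < q) (h1 : q < 1) (v : ℂ) (m : ℤ) :
    besselJ (q ^ 2) v ((q : ℂ) ^ m) = besselZ (q ^ 2) m ((q : ℂ) ^ v) := by
  have hq := ofReal_ne_zero_of_pos h0
  have hp0 : 0 < q ^ 2 := by positivity
  have hp1 : q ^ 2 < 1 := pow_lt_one₀ h0.le h1 two_ne_zero
  have hp := ofReal_ne_zero_of_pos hp0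
  have hx : (q : ℂ) ^ v ≠ 0 := by simp [Complex.cpow_eq_zero_iff, hq]
  have hne := qPochInf_ne_zero hp0 hp1 (norm_ofReal_lt_one hp0 hp1)
  have hlog : (Complex.log q).im = 0 := by
    rw [← Complex.ofReal_log h0.le, Complex.ofReal_im]
  have ew : ∀ l : ℕ, ((q ^ 2 : ℝ) : ℂ) ^ (v + 1 + l) =
      (q ^ 2 : ℝ) * (((q : ℂ) ^ v) ^ 2 * ((q ^ 2 : ℝ) : ℂ) ^ l) := by
    intro l
    rw [Complex.cpow_add _ _ hp, Complex.cpow_add _ _ hp, Complex.cpow_natCast, Complex.cpow_one]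
    have : ((q ^ 2 : ℝ) : ℂ) ^ v = ((q : ℂ) ^ v) ^ 2 := by
      rw [← Complex.cpow_mul_nat, mul_comm v, Complex.cpow_mul]
      · simp
      · simp [hlog, Real.pi_pos]
      · simp [hlog, Real.pi_pos.le]
    rw [this]
    ring
  -- With w = q^(2v) and z = q^(2m), the exchange of w and z is the exchange of order and exponent.
  have h := tsum_qPochInf_symm hp0 hp1 (((q : ℂ) ^ v) ^ 2) (((q ^ 2 : ℝ) : ℂ) ^ m)
  have e1 : besselJ (q ^ 2) v ((q : ℂ) ^ m) = ((q : ℂ) ^ v) ^ m / qPochInf (q ^ 2 : ℝ) (q ^ 2) *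
      ∑' l : ℕ, (-1) ^ l * ((q ^ 2 : ℝ) : ℂ) ^ (l * (l + 1) / 2) *
        (qPoch (q ^ 2 : ℝ) (q ^ 2) l)⁻¹ *
        qPochInf ((q ^ 2 : ℝ) * (((q : ℂ) ^ v) ^ 2 * ((q ^ 2 : ℝ) : ℂ) ^ l)) (q ^ 2) *
          (((q ^ 2 : ℝ) : ℂ) ^ m) ^ l := by
    unfold besselJ
    rw [zpow_cpow h0]
    congr 1
    refine tsum_congr fun l => ?_
    have e2 : ((q : ℂ) ^ m) ^ (2 * l) = (((q ^ 2 : ℝ) : ℂ) ^ m) ^ l := by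
      rw [pow_mul, Complex.ofReal_pow, sq, sq, mul_zpow]
    rw [ew, e2]
    ring
  rw [e1, h, besselZ, ← tsum_mul_left]
  refine tsum_congr fun l => ?_
  have e3 : qPochInf ((q ^ 2 : ℝ) * (((q ^ 2 : ℝ) : ℂ) ^ m * ((q ^ 2 : ℝ) : ℂ) ^ l)) (q ^ 2) =
      qPochInf (q ^ 2 : ℝ) (q ^ 2) * invFact (q ^ 2) (m + l) := by
    rw [← qPochInf_zpow hp0 hp1, zpow_add₀ hp, zpow_natCast]
  rw [e3, besselTerm, zpow_add₀ hx, zpow_mul, zpow_natCast, zpow_ofNat]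
  field_simp

/-! ### Rearrangement of multiple series and the generating functions. -/

theorem HasSum.of_eq {α : Type*} {f g : α → ℂ} {a b : ℂ} (h : HasSum f a) (hfg : ∀ x, g x = f x)
    (hab : b = a) : HasSum g b := by
  rw [hab, funext hfg]
  exact h

theorem HasSum.prod_mul {α β : Type*} {f : α → ℂ} {g : β → ℂ} {a b : ℂ} (hf : HasSum f a)
    (hg : HasSum g b) : HasSum (fun x : α × β => f x.1 * g x.2) (a * b) :=
  hf.mul hg (summable_mul_of_summable_norm hf.summable.norm hg.summable.norm)

theorem Summable.hasSum_of_prod_fiberwise {α β : Type*} {f : α × β → ℂ} {g : α → ℂ} {a : ℂ}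
    (hf : Summable f) (hg : ∀ b, HasSum (fun c => f (b, c)) (g b)) (ha : HasSum g a) :
    HasSum f a := by
  rw [← (hf.hasSum.prod_fiberwise hg).unique ha]
  exact hf.hasSum

/-- Serves to regroup a product of one-sided power series by total exponent: φ embeds its index set,
and the terms outside the image vanish because of `invFact`. -/
theorem HasSum.prod_fiberwise_of_comp {α β γ : Type*} {φ : γ → α × β} (hφ : Function.Injective φ)
    {F : γ → ℂ} {f : α × β → ℂ} {g : α → ℂ} {a : ℂ} (hF : HasSum F a)
    (hzero : ∀ y ∉ Set.range φ, f y = 0) (hcomp : ∀ y, f (φ y) = F y)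
    (hg : ∀ b, HasSum (fun c => f (b, c)) (g b)) : HasSum g a :=
  ((hφ.hasSum_iff hzero).1 (HasSum.of_eq hF hcomp rfl)).prod_fiberwise hg

/-- The generating function of the Hahn-Exton functions of integer order. -/
theorem hasSum_generating (h0 : 0 < p) (h1 : p < 1) {x s : ℂ} (hx : x ≠ 0) (hs : s ≠ 0)
    (hxs : ‖x * s‖ < 1) :
    HasSum (fun n : ℤ => besselZ p n x * s ^ n) (qPochInf (p * (x / s)) p / qPochInf (x * s) p) := by
  have hF := hasSum_inv_qPochInf h0 h1 hxs
  have hH := hasSum_qPochInf h0 h1 (x / s)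
  have hFH := HasSum.prod_mul hF hH
  -- The term with (x s)^L (x/s)^l carries s^(L-l), hence belongs to order n = L - l.
  set φ : ℕ × ℕ → ℤ × ℕ := fun y => ((y.1 : ℤ) - y.2, y.2) with hφ
  have hinj : Function.Injective φ := by
    rintro ⟨a, b⟩ ⟨c, d⟩ h
    simp only [hφ, Prod.mk.injEq] at h ⊢
    omega
  have hzero : ∀ y ∉ Set.range φ, besselTerm p y.1 x y.2 * s ^ y.1 = 0 := by
    rintro ⟨n, l⟩ hy
    have hn : n + l < 0 := by
      by_contra! h
      exact hy ⟨((n + l).toNat, l), by simp [hφ, h]⟩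
    simp [besselTerm, invFact_of_neg hn]
  have hcomp : ∀ y, besselTerm p (φ y).1 x (φ y).2 * s ^ (φ y).1 =
      (qPoch p p y.1)⁻¹ * (x * s) ^ y.1 *
        ((-1) ^ y.2 * (p : ℂ) ^ (y.2 * (y.2 + 1) / 2) * (qPoch p p y.2)⁻¹ * (x / s) ^ y.2) := by
    rintro ⟨L, l⟩
    have e : (L : ℤ) - l + 2 * l = (L + l : ℕ) := by push_cast; ring
    simp only [hφ, besselTerm, sub_add_cancel, invFact_natCast, e, zpow_natCast,
      zpow_sub₀ hs, div_pow, mul_pow, pow_add]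
    ring
  rw [div_eq_inv_mul]
  have hfib : ∀ n : ℤ, HasSum (fun l => besselTerm p n x l * s ^ n) (besselZ p n x * s ^ n) :=
    fun n => (hasSum_besselZ h0 h1 n hx).mul_right (s ^ n)
  exact HasSum.prod_fiberwise_of_comp (f := fun y : ℤ × ℕ => besselTerm p y.1 x y.2 * s ^ y.1)
    hinj hFH hzero hcomp hfib

/-- The two-variable `q`-binomial theorem. -/
theorem hasSum_double_qBinomial (h0 : 0 < p) (h1 : p < 1) {X Y : ℂ} (hX : ‖X‖ < 1)
    (hY : ‖Y‖ < 1) :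
    HasSum (fun y : ℕ × ℕ => (qPoch p p y.1)⁻¹ * X ^ y.1 * ((qPoch p p y.2)⁻¹ * Y ^ y.2) *
        (p : ℂ) ^ (y.1 * y.2))
      (qPochInf (X * Y) p / (qPochInf X p * qPochInf Y p)) := by
  have hp := norm_ofReal_lt_one h0 h1
  have hsum : Summable fun y : ℕ × ℕ => (qPoch p p y.1)⁻¹ * X ^ y.1 *
      ((qPoch p p y.2)⁻¹ * Y ^ y.2) * (p : ℂ) ^ (y.1 * y.2) := by
    have h := summable_mul_of_summable_norm (hasSum_inv_qPochInf h0 h1 hX).summable.norm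
      (hasSum_inv_qPochInf h0 h1 hY).summable.norm
    refine Summable.of_norm_bounded h.norm fun x => ?_
    rw [norm_mul]
    refine mul_le_of_le_one_right (norm_nonneg _) ?_
    rw [norm_pow]
    exact pow_le_one₀ (norm_nonneg _) hp.le
  -- For fixed L the inner sum is 1/(Y p^L; p)_∞ = (Y; p)_L / (Y; p)_∞; the outer sum is then the
  -- q-binomial series in X.
  refine Summable.hasSum_of_prod_fiberwise hsum (g := fun L => (qPoch Y p L / qPoch p p L * X ^ L) *
    (qPochInf Y p)⁻¹) (fun L => ?_) ?_
  · have hYL : ‖Y * (p : ℂ) ^ L‖ < 1 := by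
      rw [norm_mul, norm_pow]
      exact mul_lt_one_of_nonneg_of_lt_one_left (norm_nonneg _) hY
        (pow_le_one₀ (norm_nonneg _) hp.le)
    have h := (hasSum_inv_qPochInf h0 h1 hYL).mul_left ((qPoch p p L)⁻¹ * X ^ L)
    have e : (qPochInf (Y * (p : ℂ) ^ L) p)⁻¹ = qPoch Y p L * (qPochInf Y p)⁻¹ := by
      have := qPoch_ne_zero_of_norm_lt h0 h1 hY L
      rw [← qPoch_mul_qPochInf_shift h0 h1 Y L, mul_inv, mul_inv_cancel_left₀ this]
    rw [e] at h
    refine HasSum.of_eq h (fun N => ?_) ?_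
    · rw [mul_pow, pow_mul]
      ring
    · ring
  · have h := (hasSum_qBinomial h0 h1 Y hX).mul_right (qPochInf Y p)⁻¹
    rwa [div_mul_eq_mul_div, ← div_eq_mul_inv, div_div, mul_comm Y X,
      mul_comm (qPochInf Y p)] at h

/-- With T(n) = n(n+1)/2 and n = l + d, this says T(n) + T(l) - ln = T(d) + l: division by p^(ln)
leaves quadratic decay off the diagonal but only linear decay along it. -/
theorem triangle_add (l d : ℕ) :
    (l + d) * (l + d + 1) / 2 + l * (l + 1) / 2 = l * (l + d) + d * (d + 1) / 2 + l := by
  have h : ∀ n : ℕ, 2 * (n * (n + 1) / 2) = n * (n + 1) := fun n =>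
    Nat.two_mul_div_two_of_even (Nat.even_mul_succ_self n)
  have e1 := h (l + d)
  have e2 := h l
  have e3 := h d
  generalize (l + d) * (l + d + 1) / 2 = a at *
  generalize l * (l + 1) / 2 = b at *
  generalize d * (d + 1) / 2 = c at *
  nlinarith

theorem qPoch_succ' (a : ℂ) (n : ℕ) : qPoch a p (n + 1) = (1 - a) * qPoch (a * p) p n := by
  simp only [qPoch, Finset.prod_range_succ', pow_zero, mul_one]
  rw [mul_comm]
  congr 1
  exact Finset.prod_congr rfl fun i _ => by ring

/-- The factors on the left are 1 - U p^(-j) = -U p^(-j) (1 - U⁻¹ p^j) for j < l; the triangular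
power absorbs the negative ones and leaves p^l. -/
theorem triangle_mul_qPoch (h0 : 0 < p) {U : ℂ} (hU : U ≠ 0) (l : ℕ) :
    (p : ℂ) ^ (l * (l + 1) / 2) * qPoch (p * (U / p ^ l)) p l =
      (-U) ^ l * p ^ l * qPoch U⁻¹ p l := by
  have hp := ofReal_ne_zero_of_pos h0
  induction l with
  | zero => simp [qPoch_zero]
  | succ l ih =>
    have e : (p : ℂ) * (U / p ^ (l + 1)) * p = p * (U / p ^ l) := by
      field_simp
      ring
    have e' : (p : ℂ) ^ (l + 1) * (1 - p * (U / p ^ (l + 1))) = -U * p * (1 - U⁻¹ * p ^ l) := by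
      field_simp
      ring
    rw [qPoch_succ', e, triangle_succ, pow_add _ _ (l + 1), qPoch_succ]
    linear_combination (p : ℂ) ^ (l + 1) * (1 - p * (U / p ^ (l + 1))) * ih +
      (-U) ^ l * p ^ l * qPoch U⁻¹ p l * e'

theorem exists_triangle_le_mul_pow (h0 : 0 < p) (h1 : p < 1) {ρ : ℝ} (hρ : 0 < ρ) (x : ℝ)
    (hx : 0 ≤ x) : ∃ C : ℝ, 0 < C ∧ ∀ n : ℕ, p ^ (n * (n + 1) / 2) * x ^ n ≤ C * ρ ^ n := by
  obtain ⟨C, hC, h⟩ := exists_triangle_le h0 h1 (x / ρ)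
  refine ⟨C, hC, fun n => ?_⟩
  have := h n
  rw [abs_of_nonneg (by positivity), div_pow, ← mul_div_assoc, div_le_iff₀ (by positivity)] at this
  exact this

/-- By `triangle_add` the term is p^T(d) U^d (pUV)^l. The first part decays faster than any
geometric sequence, the second is geometric with ratio at most ρ². -/
theorem triangle_mul_div_le (h0 : 0 < p) {U V ρ C : ℝ} (hU : 0 ≤ U) (hV : 0 ≤ V)
    (hUV : p * (U * V) ≤ ρ ^ 2)
    (hC : ∀ n : ℕ, p ^ (n * (n + 1) / 2) * U ^ n ≤ C * ρ ^ n) (l d : ℕ) :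
    p ^ (l * (l + 1) / 2) * p ^ ((l + d) * (l + d + 1) / 2) / p ^ (l * (l + d)) *
      (V ^ l * U ^ (l + d)) ≤ C * (ρ ^ l * ρ ^ (l + d)) := by
  have e : p ^ (l * (l + 1) / 2) * p ^ ((l + d) * (l + d + 1) / 2) / p ^ (l * (l + d)) *
      (V ^ l * U ^ (l + d)) = p ^ (d * (d + 1) / 2) * U ^ d * (p * (U * V)) ^ l := by
    rw [← pow_add, add_comm (l * (l + 1) / 2), triangle_add, pow_add, pow_add, add_comm l d,
      pow_add U, mul_pow, mul_pow]
    field_simp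
  have e' : C * (ρ ^ l * ρ ^ (l + d)) = C * ρ ^ d * (ρ ^ 2) ^ l := by ring
  rw [e, e']
  have : 0 ≤ C * ρ ^ d := le_trans (by positivity) (hC d)
  exact mul_le_mul (hC d) (by gcongr) (by positivity) this

theorem summable_double_triangle (h0 : 0 < p) (h1 : p < 1) {U V : ℂ}
    (hUV : ‖p * (U * V)‖ < 1) :
    Summable fun y : ℕ × ℕ => (p : ℂ) ^ (y.1 * (y.1 + 1) / 2) * (p : ℂ) ^ (y.2 * (y.2 + 1) / 2) /
      (p : ℂ) ^ (y.1 * y.2) * (V ^ y.1 * U ^ y.2) := by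
  -- A square root is taken so that the diagonal decay is shared equally by the two indices, giving
  -- the majorant ρ^l ρ^n.
  obtain ⟨ρ, hρ0, hρ1, hρ⟩ : ∃ ρ : ℝ, 0 < ρ ∧ ρ < 1 ∧ p * (‖U‖ * ‖V‖) ≤ ρ ^ 2 := by
    rw [norm_mul, norm_mul, Complex.norm_real, Real.norm_of_nonneg h0.le] at hUV
    obtain ⟨r, hr, hr1⟩ := exists_between hUV
    have hr0 : 0 < r := lt_of_le_of_lt (by positivity) hr
    refine ⟨√r, Real.sqrt_pos.2 hr0, ?_, ?_⟩
    · rw [Real.sqrt_lt' one_pos]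
      simpa using hr1
    · rw [Real.sq_sqrt hr0.le]
      exact hr.le
  obtain ⟨C, hC, hCU⟩ := exists_triangle_le_mul_pow h0 h1 hρ0 ‖U‖ (norm_nonneg _)
  obtain ⟨D, hD, hDV⟩ := exists_triangle_le_mul_pow h0 h1 hρ0 ‖V‖ (norm_nonneg _)
  have hg := summable_geometric_of_lt_one hρ0.le hρ1
  have hgg := (hg.mul_of_nonneg hg (fun n => by positivity) (fun n => by positivity)).mul_left
    (C + D)
  refine Summable.of_norm_bounded hgg fun y => ?_
  obtain ⟨l, n⟩ := y
  simp only [norm_mul, norm_div, norm_pow, Complex.norm_real, Real.norm_of_nonneg h0.le]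
  have hpos : 0 ≤ ρ ^ l * ρ ^ n := by positivity
  rcases le_total l n with h | h
  · obtain ⟨d, rfl⟩ := Nat.exists_eq_add_of_le h
    refine (triangle_mul_div_le h0 (norm_nonneg _) (norm_nonneg _) hρ hCU l d).trans ?_
    gcongr
    linarith
  · obtain ⟨d, rfl⟩ := Nat.exists_eq_add_of_le h
    rw [mul_comm ‖U‖] at hρ
    have := triangle_mul_div_le h0 (norm_nonneg _) (norm_nonneg _) hρ hDV n d
    rw [mul_comm (p ^ ((n + d) * (n + d + 1) / 2)), mul_comm (n + d) n, mul_comm (‖V‖ ^ (n + d)),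
      mul_comm (ρ ^ (n + d))]
    refine this.trans ?_
    gcongr
    linarith

theorem hasSum_double_triangle (h0 : 0 < p) (h1 : p < 1) {U V : ℂ} (hU : U ≠ 0)
    (hUV : ‖p * (U * V)‖ < 1) :
    HasSum (fun y : ℕ × ℕ =>
        (-1) ^ y.1 * (p : ℂ) ^ (y.1 * (y.1 + 1) / 2) * (qPoch p p y.1)⁻¹ * V ^ y.1 *
        ((-1) ^ y.2 * (p : ℂ) ^ (y.2 * (y.2 + 1) / 2) * (qPoch p p y.2)⁻¹ * U ^ y.2) /
        (p : ℂ) ^ (y.1 * y.2))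
      (qPochInf (p * U) p * qPochInf (p * V) p / qPochInf (p * (U * V)) p) := by
  have hp := ofReal_ne_zero_of_pos h0
  have hsum : Summable fun y : ℕ × ℕ =>
        (-1) ^ y.1 * (p : ℂ) ^ (y.1 * (y.1 + 1) / 2) * (qPoch p p y.1)⁻¹ * V ^ y.1 *
        ((-1) ^ y.2 * (p : ℂ) ^ (y.2 * (y.2 + 1) / 2) * (qPoch p p y.2)⁻¹ * U ^ y.2) /
        (p : ℂ) ^ (y.1 * y.2) := by
    obtain ⟨C, hC, h⟩ := exists_norm_inv_qPoch_le h0 h1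
    refine Summable.of_norm_bounded ((summable_double_triangle h0 h1 hUV).norm.mul_left (C * C))
      fun y => ?_
    have e : (-1) ^ y.1 * (p : ℂ) ^ (y.1 * (y.1 + 1) / 2) * (qPoch p p y.1)⁻¹ * V ^ y.1 *
        ((-1) ^ y.2 * (p : ℂ) ^ (y.2 * (y.2 + 1) / 2) * (qPoch p p y.2)⁻¹ * U ^ y.2) /
        (p : ℂ) ^ (y.1 * y.2) = (-1) ^ (y.1 + y.2) * ((qPoch p p y.1)⁻¹ * (qPoch p p y.2)⁻¹ *
        ((p : ℂ) ^ (y.1 * (y.1 + 1) / 2) * (p : ℂ) ^ (y.2 * (y.2 + 1) / 2) /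
      (p : ℂ) ^ (y.1 * y.2) * (V ^ y.1 * U ^ y.2))) := by ring
    rw [e, norm_mul, norm_pow, norm_neg, norm_one, one_pow, one_mul, norm_mul, norm_mul]
    gcongr
    · exact h _
    · exact h _
  -- Euler's expansion sums the row l to (pU p^(-l); p)_∞; reversing its first l factors gives a
  -- q-binomial series with X = U⁻¹ and Y = pUV.
  refine Summable.hasSum_of_prod_fiberwise hsum (g := fun l => qPochInf (p * U) p *
    (qPoch U⁻¹ p l / qPoch p p l * (p * (U * V)) ^ l)) (fun l => ?_) ?_
  · have h := (hasSum_qPochInf h0 h1 (U / p ^ l)).mul_left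
      ((-1) ^ l * (p : ℂ) ^ (l * (l + 1) / 2) * (qPoch p p l)⁻¹ * V ^ l)
    have e : p * (U / p ^ l) * (p : ℂ) ^ l = p * U := by field_simp
    rw [← qPoch_mul_qPochInf_shift h0 h1 _ l, e] at h
    refine HasSum.of_eq h (fun n => ?_) ?_
    · rw [div_pow, ← pow_mul]
      ring
    · have e2 := triangle_mul_qPoch h0 hU l
      have e3 : (-1 : ℂ) ^ l * (-U) ^ l = U ^ l := by rw [← mul_pow]; simp
      rw [mul_pow, mul_pow, div_eq_mul_inv]
      linear_combination (-(-1) ^ l * (qPoch p p l)⁻¹ * V ^ l * qPochInf (p * U) p) * e2 -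
        p ^ l * qPoch U⁻¹ p l * (qPoch p p l)⁻¹ * V ^ l * qPochInf (p * U) p * e3
  · have h := (hasSum_qBinomial h0 h1 U⁻¹ hUV).mul_left (qPochInf (p * U) p)
    have e : U⁻¹ * (p * (U * V)) = p * V := by field_simp
    rwa [e, ← mul_div_assoc] at h

/-- The generating function of the products `J_i(a q^j) J_j(b q^i)`. -/
theorem hasSum_product_generating {q : ℝ} (h0 : 0 < q) (h1 : q < 1) {a b s t : ℂ} (ha : a ≠ 0)
    (hb : b ≠ 0) (hs : s ≠ 0) (ht : t ≠ 0) (has : ‖a * s‖ < 1) (hbt : ‖b * t‖ < 1)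
    (hab : ‖(q ^ 2 : ℝ) * ((b / t) * (a / s))‖ < 1) :
    HasSum (fun y : ℤ × ℤ => besselZ (q ^ 2) y.1 (a * q ^ y.2) * besselZ (q ^ 2) y.2 (b * q ^ y.1) *
        (s ^ y.1 * t ^ y.2))
      (qPochInf (a * s * (b * t)) (q ^ 2) / (qPochInf (a * s) (q ^ 2) * qPochInf (b * t) (q ^ 2)) *
        (qPochInf ((q ^ 2 : ℝ) * (b / t)) (q ^ 2) * qPochInf ((q ^ 2 : ℝ) * (a / s)) (q ^ 2) /
          qPochInf ((q ^ 2 : ℝ) * ((b / t) * (a / s))) (q ^ 2))) := by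
  have hq := ofReal_ne_zero_of_pos h0
  have hp0 : 0 < q ^ 2 := by positivity
  have hp1 : q ^ 2 < 1 := pow_lt_one₀ h0.le h1 two_ne_zero
  set p := q ^ 2 with hpq
  have hF := hasSum_double_qBinomial hp0 hp1 has hbt
  have hH := hasSum_double_triangle hp0 hp1 (U := b / t) (V := a / s) (by positivity) hab
  have hFH := HasSum.prod_mul hF hH
  set φ : (ℕ × ℕ) × (ℕ × ℕ) → (ℤ × ℤ) × (ℕ × ℕ) :=
    fun y => (((y.1.1 : ℤ) - y.2.1, (y.1.2 : ℤ) - y.2.2), y.2) with hφ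
  have hinj : Function.Injective φ := by
    rintro ⟨⟨a, b⟩, ⟨c, d⟩⟩ ⟨⟨a', b'⟩, ⟨c', d'⟩⟩ h
    simp only [hφ, Prod.mk.injEq] at h ⊢
    omega
  set g : (ℤ × ℤ) × (ℕ × ℕ) → ℂ := fun y =>
    besselTerm p y.1.1 (a * q ^ y.1.2) y.2.1 * besselTerm p y.1.2 (b * q ^ y.1.1) y.2.2 *
      (s ^ y.1.1 * t ^ y.1.2) with hg
  have hzero : ∀ y ∉ Set.range φ, g y = 0 := by
    rintro ⟨⟨i, j⟩, ⟨l, n⟩⟩ hy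
    have hn : i + l < 0 ∨ j + n < 0 := by
      by_contra! h
      exact hy ⟨(((i + l).toNat, (j + n).toNat), (l, n)), by simp [hφ, h]⟩
    rcases hn with hn | hn <;> simp [hg, besselTerm, invFact_of_neg hn]
  have hcomp : ∀ y, g (φ y) = (qPoch p p y.1.1)⁻¹ * (a * s) ^ y.1.1 *
      ((qPoch p p y.1.2)⁻¹ * (b * t) ^ y.1.2) * (p : ℂ) ^ (y.1.1 * y.1.2) *
      ((-1) ^ y.2.1 * (p : ℂ) ^ (y.2.1 * (y.2.1 + 1) / 2) * (qPoch p p y.2.1)⁻¹ * (a / s) ^ y.2.1 *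
        ((-1) ^ y.2.2 * (p : ℂ) ^ (y.2.2 * (y.2.2 + 1) / 2) * (qPoch p p y.2.2)⁻¹ *
          (b / t) ^ y.2.2) / (p : ℂ) ^ (y.2.1 * y.2.2)) := by
    rintro ⟨⟨L, N⟩, ⟨l, n⟩⟩
    have e1 : (L : ℤ) - l + 2 * l = (L + l : ℕ) := by push_cast; ring
    have e2 : (N : ℤ) - n + 2 * n = (N + n : ℕ) := by push_cast; ring
    -- The decoupling that makes the fourfold sum factor: (N-n)(L+l) + (L-l)(N+n) = 2LN - 2ln, with
    -- no mixed terms.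
    have e3 : ((q : ℂ) ^ ((N : ℤ) - n)) ^ (L + l) * ((q : ℂ) ^ ((L : ℤ) - l)) ^ (N + n) =
        (p : ℂ) ^ (L * N) / (p : ℂ) ^ (l * n) := by
      rw [← zpow_natCast, ← zpow_natCast, ← zpow_mul, ← zpow_mul, ← zpow_add₀ hq, hpq,
        Complex.ofReal_pow, ← pow_mul, ← pow_mul, ← zpow_natCast, ← zpow_natCast, ← zpow_sub₀ hq]
      congr 1
      push_cast
      ring
    simp only [hφ, hg, besselTerm, sub_add_cancel, invFact_natCast, e1, e2,
      zpow_natCast, zpow_sub₀ hs, zpow_sub₀ ht, div_pow, mul_pow a, mul_pow b, pow_add a, pow_add b]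
    linear_combination ((-1) ^ l * (p : ℂ) ^ (l * (l + 1) / 2) * (qPoch p p l)⁻¹ * (qPoch p p L)⁻¹ *
      (a ^ L * a ^ l) * ((-1) ^ n * (p : ℂ) ^ (n * (n + 1) / 2) * (qPoch p p n)⁻¹ *
      (qPoch p p N)⁻¹ * (b ^ N * b ^ n)) * (s ^ L / s ^ l * (t ^ N / t ^ n))) * e3
  refine HasSum.prod_fiberwise_of_comp (f := g) hinj hFH hzero hcomp fun y => ?_
  have hb1 := hasSum_besselZ hp0 hp1 y.1 (x := a * q ^ y.2) (by positivity)
  have hb2 := hasSum_besselZ hp0 hp1 y.2 (x := b * q ^ y.1) (by positivity)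
  exact (HasSum.prod_mul hb1 hb2).mul_right (s ^ y.1 * t ^ y.2)

end IntegerOrder

/-! ### Uniqueness and multiplication of Laurent series. -/

/-- Absolute summability makes the Fourier series converge uniformly on the circle, so it may be
paired term by term with one mode in L², and orthonormality isolates one coefficient. -/
theorem eq_zero_of_hasSum_zpow {c : ℤ → ℂ} (hc : Summable c)
    (h : ∀ u : ℂ, ‖u‖ = 1 → HasSum (fun n => c n * u ^ n) 0) (m : ℤ) : c m = 0 := by
  have : Fact (0 < (1 : ℝ)) := ⟨one_pos⟩
  have hsum : Summable fun n => c n • (fourier n : C(AddCircle (1 : ℝ), ℂ)) := by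
    refine Summable.of_norm_bounded hc.norm fun n => ?_
    rw [norm_smul, fourier_norm, mul_one]
  have hzero : HasSum (fun n => c n • (fourier n : C(AddCircle (1 : ℝ), ℂ))) 0 := by
    have e : ∑' n, c n • (fourier n : C(AddCircle (1 : ℝ), ℂ)) = 0 := by
      ext x
      have h1 := ContinuousMap.hasSum_apply hsum.hasSum x
      refine h1.unique (HasSum.of_eq (h (AddCircle.toCircle x) (Circle.norm_coe _)) ?_ rfl)
      intro n
      simp [fourier_apply, AddCircle.toCircle_zsmul]
    rw [← e]
    exact hsum.hasSum
  have h2 := hzero.mapL (ContinuousMap.toLp (E := ℂ) 2 AddCircle.haarAddCircle ℂ)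
  have h3 := h2.mapL (innerSL ℂ (fourierLp (T := (1 : ℝ)) 2 m))
  rw [map_zero, map_zero] at h3
  have h4 : HasSum (fun n => if n = m then c m else 0) 0 := by
    refine HasSum.of_eq h3 (fun n => ?_) rfl
    rw [map_smul, innerSL_apply_apply, inner_smul_right]
    have := (orthonormal_iff_ite.1 (orthonormal_fourier (T := (1 : ℝ)))) m n
    simp only [fourierLp] at this ⊢
    rw [this]
    by_cases hnm : n = m
    · simp [hnm]
    · simp [hnm, Ne.symm hnm]
  exact (hasSum_ite_eq m (c m)).unique h4

/-- One variable at a time: for fixed w the row sums are the coefficients of a series in u, and each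
row is then a series in w. -/
theorem eq_zero_of_hasSum_zpow_mul_zpow {c : ℤ × ℤ → ℂ} (hc : Summable c)
    (h : ∀ u w : ℂ, ‖u‖ = 1 → ‖w‖ = 1 → HasSum (fun y : ℤ × ℤ => c y * (u ^ y.1 * w ^ y.2)) 0)
    (y : ℤ × ℤ) : c y = 0 := by
  have hfac : ∀ n, Summable fun k => c (n, k) := fun n => hc.prod_factor n
  have hw : ∀ w : ℂ, ‖w‖ = 1 → ∀ n, Summable fun k => c (n, k) * w ^ k := fun w hw n => by
    refine Summable.of_norm_bounded (hfac n).norm fun k => ?_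
    simp [hw]
  have key : ∀ w : ℂ, ‖w‖ = 1 → ∀ n, ∑' k, c (n, k) * w ^ k = 0 := by
    intro w hw1
    refine eq_zero_of_hasSum_zpow ?_ ?_
    · have hs : Summable fun y : ℤ × ℤ => c y * w ^ y.2 := by
        refine Summable.of_norm_bounded hc.norm fun y => ?_
        simp [hw1]
      exact hs.prod
    · intro u hu
      refine (h u w hu hw1).prod_fiberwise fun n => ?_
      exact HasSum.of_eq ((hw w hw1 n).hasSum.mul_right (u ^ n)) (fun k => by ring) rfl
  refine eq_zero_of_hasSum_zpow (hfac y.1) (fun w hw1 => ?_) y.2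
  rw [← key w hw1 y.1]
  exact (hw w hw1 y.1).hasSum

/-- Uniqueness of the coefficients of a double Laurent series on a torus. -/
theorem laurent_unique {c d : ℤ × ℤ → ℂ} {s t : ℂ} (hs : s ≠ 0) (ht : t ≠ 0) {f : ℂ → ℂ → ℂ}
    (hc : ∀ u w : ℂ, ‖u‖ = 1 → ‖w‖ = 1 →
      HasSum (fun y : ℤ × ℤ => c y * ((s * u) ^ y.1 * (t * w) ^ y.2)) (f u w))
    (hd : ∀ u w : ℂ, ‖u‖ = 1 → ‖w‖ = 1 →
      HasSum (fun y : ℤ × ℤ => d y * ((s * u) ^ y.1 * (t * w) ^ y.2)) (f u w)) (y : ℤ × ℤ) :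
    c y = d y := by
  have key := eq_zero_of_hasSum_zpow_mul_zpow
    (c := fun y => (c y - d y) * (s ^ y.1 * t ^ y.2)) ?_ ?_ y
  · have hne : s ^ y.1 * t ^ y.2 ≠ 0 := mul_ne_zero (zpow_ne_zero _ hs) (zpow_ne_zero _ ht)
    exact sub_eq_zero.1 ((mul_eq_zero.1 key).resolve_right hne)
  · have h := ((hc 1 1 norm_one norm_one).sub (hd 1 1 norm_one norm_one)).summable
    refine h.congr fun y => ?_
    rw [mul_one, mul_one]
    ring
  · intro u w hu hw
    refine HasSum.of_eq ((hc u w hu hw).sub (hd u w hu hw)) (fun y => ?_) (by ring)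
    rw [mul_zpow, mul_zpow]
    ring

/-- Multiplication of a double Laurent series by a series in the product of the variables. -/
theorem hasSum_convolution {A : ℤ × ℤ → ℂ} {B : ℤ → ℂ} {s t α β : ℂ} (hs : s ≠ 0) (ht : t ≠ 0)
    (hA : HasSum (fun y : ℤ × ℤ => A y * (s ^ y.1 * t ^ y.2)) α)
    (hB : HasSum (fun k => B k * (s * t) ^ k) β) :
    (∀ y : ℤ × ℤ, Summable fun k => A (y.1 - k, y.2 - k) * B k) ∧
      HasSum (fun y : ℤ × ℤ => (∑' k, A (y.1 - k, y.2 - k) * B k) * (s ^ y.1 * t ^ y.2))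
        (α * β) := by
  -- Since the second series depends on st only, collecting powers is a shear along the diagonal.
  let e : (ℤ × ℤ) × ℤ ≃ (ℤ × ℤ) × ℤ :=
    { toFun := fun x => ((x.1.1 - x.2, x.1.2 - x.2), x.2)
      invFun := fun x => ((x.1.1 + x.2, x.1.2 + x.2), x.2)
      left_inv := fun x => by simp
      right_inv := fun x => by simp }
  have h1 := e.hasSum_iff.2 (HasSum.prod_mul hA hB)
  have h2 : HasSum (fun x : (ℤ × ℤ) × ℤ => A (x.1.1 - x.2, x.1.2 - x.2) * B x.2 *
      (s ^ x.1.1 * t ^ x.1.2)) (α * β) := by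
    refine HasSum.of_eq h1 (fun x => ?_) rfl
    simp only [Function.comp, e, Equiv.coe_fn_mk, zpow_sub₀ hs, zpow_sub₀ ht, mul_zpow]
    have := zpow_ne_zero x.2 hs
    have := zpow_ne_zero x.2 ht
    field_simp
  have h3 : ∀ y : ℤ × ℤ, Summable fun k => A (y.1 - k, y.2 - k) * B k := fun y => by
    have h := h2.summable.prod_factor y
    have hne : s ^ y.1 * t ^ y.2 ≠ 0 := mul_ne_zero (zpow_ne_zero _ hs) (zpow_ne_zero _ ht)
    exact (summable_mul_right_iff hne).1 h
  have h4 : ∀ y : ℤ × ℤ, HasSum (fun k => A (y.1 - k, y.2 - k) * B k * (s ^ y.1 * t ^ y.2))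
      ((∑' k, A (y.1 - k, y.2 - k) * B k) * (s ^ y.1 * t ^ y.2)) := fun y =>
    (h3 y).hasSum.mul_right (s ^ y.1 * t ^ y.2)
  exact ⟨h3, h2.prod_fiberwise h4⟩

/-! ### The product formula and its inverse for integer order. -/

section ProductFormula

variable {q : ℝ} {a b : ℂ}

/-- With |as| = |bt| = ρ one has |st| = ρ²/|ab|, so all the conditions reduce to q|ab| < ρ < 1. -/
theorem exists_radius (h0 : 0 < q) (h1 : q < 1) (ha : a ≠ 0) (hb : b ≠ 0)
    (hab : ‖a * b‖ < q⁻¹) :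
    ∃ s t : ℂ, s ≠ 0 ∧ t ≠ 0 ∧ ‖a * s‖ < 1 ∧ ‖b * t‖ < 1 ∧
      q ^ 2 * ‖a * b‖ < ‖s * t‖ ∧ ‖a * b‖ * ‖s * t‖ < 1 := by
  have hab0 : 0 < ‖a * b‖ := norm_pos_iff.2 (mul_ne_zero ha hb)
  have hlt : q * ‖a * b‖ < 1 := by
    rwa [lt_inv_comm₀ hab0 h0, lt_inv_comm₀ h0 hab0, ← one_div, lt_div_iff₀ h0, mul_comm] at hab
  obtain ⟨ρ, hρ, hρ1⟩ := exists_between hlt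
  have hρ0 : 0 < ρ := lt_trans (by positivity) hρ
  have hρn : ‖(ρ : ℂ)‖ = ρ := by rw [Complex.norm_real, Real.norm_of_nonneg hρ0.le]
  have hρc : (ρ : ℂ) ≠ 0 := by exact_mod_cast hρ0.ne'
  have est : ‖ρ / a * (ρ / b)‖ = ρ ^ 2 / ‖a * b‖ := by
    rw [div_mul_div_comm, norm_div, norm_mul, hρn, sq]
  refine ⟨ρ / a, ρ / b, div_ne_zero hρc ha, div_ne_zero hρc hb, ?_, ?_, ?_, ?_⟩
  · rwa [mul_div_cancel₀ _ ha, hρn]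
  · rwa [mul_div_cancel₀ _ hb, hρn]
  · rw [est, lt_div_iff₀ hab0]
    nlinarith [mul_pos h0 hab0]
  · rw [est, mul_div_cancel₀ _ hab0.ne']
    nlinarith

/-- The product `J_i(a q^j) J_j(b q^i)`. -/
noncomputable def pairK (q : ℝ) (a b : ℂ) (y : ℤ × ℤ) : ℂ :=
  besselZ (q ^ 2) y.1 (a * q ^ y.2) * besselZ (q ^ 2) y.2 (b * q ^ y.1)

/-- Coefficients of s^m t^z in G_a G_b = K·G_{ab} and in K = G_a G_b·(1/G_{ab}), where K denotes the
double series of `pairK`. -/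
theorem product_formulas (h0 : 0 < q) (h1 : q < 1) (ha : a ≠ 0) (hb : b ≠ 0)
    (hab : ‖a * b‖ < q⁻¹) (m z : ℤ) :
    HasSum (fun k : ℤ => pairK q a b (m - k, z - k) * besselZ (q ^ 2) k (a * b))
        (besselZ (q ^ 2) m a * besselZ (q ^ 2) z b) ∧
      HasSum (fun l : ℤ => besselZ (q ^ 2) (m + l) a * besselZ (q ^ 2) (z + l) b *
          (((q ^ 2 : ℝ) : ℂ) ^ l * besselZ (q ^ 2) l (a * b)))
        (pairK q a b (m, z)) := by
  have hp0 : 0 < q ^ 2 := by positivity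
  have hp1 : q ^ 2 < 1 := pow_lt_one₀ h0.le h1 two_ne_zero
  have hpc := ofReal_ne_zero_of_pos hp0
  have hpn : ‖((q ^ 2 : ℝ) : ℂ)‖ = q ^ 2 := by
    rw [Complex.norm_real, Real.norm_of_nonneg hp0.le]
  obtain ⟨s, t, hs, ht, has, hbt, hst, hst'⟩ := exists_radius h0 h1 ha hb hab
  set P := q ^ 2 with hP
  have gen : ∀ s t : ℂ, s ≠ 0 → t ≠ 0 → ‖a * s‖ < 1 → ‖b * t‖ < 1 → P * ‖a * b‖ < ‖s * t‖ →
      ‖a * b‖ * ‖s * t‖ < 1 →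
      HasSum (fun y : ℤ × ℤ => besselZ P y.1 a * besselZ P y.2 b * (s ^ y.1 * t ^ y.2))
        (qPochInf (P * (a / s)) P / qPochInf (a * s) P *
          (qPochInf (P * (b / t)) P / qPochInf (b * t) P)) ∧
      HasSum (fun y : ℤ × ℤ => pairK q a b y * (s ^ y.1 * t ^ y.2))
        (qPochInf (P * (a / s)) P / qPochInf (a * s) P *
          (qPochInf (P * (b / t)) P / qPochInf (b * t) P) *
          (qPochInf (a * b * (s * t)) P / qPochInf (P * (a * b / (s * t))) P)) ∧
      HasSum (fun k : ℤ => besselZ P k (a * b) * (s * t) ^ k)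
        (qPochInf (P * (a * b / (s * t))) P / qPochInf (a * b * (s * t)) P) ∧
      HasSum (fun k : ℤ => (P : ℂ) ^ (-k) * besselZ P (-k) (a * b) * (s * t) ^ k)
        (qPochInf (a * b * (s * t)) P / qPochInf (P * (a * b / (s * t))) P) ∧
      qPochInf (a * b * (s * t)) P ≠ 0 ∧ qPochInf (P * (a * b / (s * t))) P ≠ 0 := by
    intro s t hs ht has hbt hst hst'
    have hst0 : s * t ≠ 0 := mul_ne_zero hs ht
    have hn1 : ‖(P : ℂ) * (a * b / (s * t))‖ < 1 := by
      rw [norm_mul, norm_div, hpn, ← mul_div_assoc, div_lt_one (norm_pos_iff.2 hst0)]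
      exact hst
    have hn2 : ‖a * b * (s * t)‖ < 1 := by rwa [norm_mul]
    have ga := hasSum_generating hp0 hp1 ha hs has
    have gb := hasSum_generating hp0 hp1 hb ht hbt
    have gc := hasSum_generating hp0 hp1 (mul_ne_zero ha hb) hst0 hn2
    have e1 : a * b * (P / (s * t)) = P * (a * b / (s * t)) := by ring
    -- At p/(st) the generating function is the reciprocal of its value at st; this is what gives
    -- 1/G_{ab} explicit coefficients.
    have gd := hasSum_generating hp0 hp1 (mul_ne_zero ha hb) (div_ne_zero hpc hst0)
      (by rw [e1]; exact hn1)
    have gk := hasSum_product_generating h0 h1 ha hb hs ht has hbt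
      (by rw [show b / t * (a / s) = a * b / (s * t) by field_simp]; exact hn1)
    refine ⟨?_, ?_, gc, ?_, qPochInf_ne_zero hp0 hp1 hn2, qPochInf_ne_zero hp0 hp1 hn1⟩
    · exact HasSum.of_eq (HasSum.prod_mul ga gb) (fun y => by ring) rfl
    · refine HasSum.of_eq gk (fun y => rfl) ?_
      rw [show b / t * (a / s) = a * b / (s * t) by field_simp,
        show a * s * (b * t) = a * b * (s * t) by ring]
      ring
    · have e2 : (P : ℂ) * (a * b / (P / (s * t))) = a * b * (s * t) := by field_simp
      rw [e1, e2] at gd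
      refine HasSum.of_eq ((Equiv.neg ℤ).hasSum_iff.2 gd) (fun k => ?_) rfl
      simp only [Function.comp, Equiv.neg_apply, div_zpow, zpow_neg]
      field_simp
  have gen' : ∀ u w : ℂ, ‖u‖ = 1 → ‖w‖ = 1 → _ := fun u w hu hw =>
    gen (s * u) (t * w) (mul_ne_zero hs (by rw [← norm_pos_iff, hu]; exact one_pos))
      (mul_ne_zero ht (by rw [← norm_pos_iff, hw]; exact one_pos))
      (by rwa [← mul_assoc, norm_mul, hu, mul_one]) (by rwa [← mul_assoc, norm_mul, hw, mul_one])
      (by rwa [mul_mul_mul_comm, norm_mul (s * t), norm_mul u, hu, hw, mul_one, mul_one])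
      (by rwa [mul_mul_mul_comm, norm_mul (s * t), norm_mul u, hu, hw, mul_one, mul_one])
  have hne : ∀ u : ℂ, ‖u‖ = 1 → u ≠ 0 := fun u hu => by
    rw [← norm_pos_iff, hu]
    exact one_pos
  constructor
  · have hconv := fun u w (hu : ‖u‖ = 1) (hw : ‖w‖ = 1) =>
      hasSum_convolution (mul_ne_zero hs (hne u hu)) (mul_ne_zero ht (hne w hw))
        (gen' u w hu hw).2.1 (gen' u w hu hw).2.2.1
    have key := laurent_unique hs ht (fun u w hu hw => (gen' u w hu hw).1)
      (fun u w hu hw => HasSum.of_eq (hconv u w hu hw).2 (fun y => rfl) (by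
        obtain ⟨-, -, -, -, h3, h4⟩ := gen' u w hu hw
        rw [mul_assoc, div_mul_div_cancel₀ h4, div_self h3, mul_one])) (m, z)
    have := ((hconv 1 1 norm_one norm_one).1 (m, z)).hasSum
    rw [← key] at this
    exact this
  · have hconv := fun u w (hu : ‖u‖ = 1) (hw : ‖w‖ = 1) =>
      hasSum_convolution (A := fun y : ℤ × ℤ => besselZ P y.1 a * besselZ P y.2 b)
        (mul_ne_zero hs (hne u hu)) (mul_ne_zero ht (hne w hw))
        (gen' u w hu hw).1 (gen' u w hu hw).2.2.2.1
    have key := laurent_unique hs ht (fun u w hu hw => (gen' u w hu hw).2.1)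
      (fun u w hu hw => (hconv u w hu hw).2) (m, z)
    have := ((hconv 1 1 norm_one norm_one).1 (m, z)).hasSum
    rw [← key] at this
    refine HasSum.of_eq ((Equiv.neg ℤ).hasSum_iff.2 this) (fun k => ?_) rfl
    simp [Function.comp]

end ProductFormula

/-! ### From complex order on the lattice to integer order. -/

section Bridge

variable {q : ℝ}

theorem cpow_ofReal_ne_zero (h0 : 0 < q) (v : ℂ) : (q : ℂ) ^ v ≠ 0 := by
  simp [Complex.cpow_eq_zero_iff, h0.ne']

theorem ofReal_sq_cpow (h0 : 0 < q) (v : ℂ) :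
    ((q ^ 2 : ℝ) : ℂ) ^ (v + 1) = (q : ℂ) ^ (2 * v + 2) := by
  have hlog : (Complex.log q).im = 0 := by
    rw [← Complex.ofReal_log h0.le, Complex.ofReal_im]
  rw [show 2 * v + 2 = 2 * (v + 1) by ring, Complex.cpow_mul]
  · simp
  · simp [hlog, Real.pi_pos]
  · simp [hlog, Real.pi_pos.le]

theorem one_sub_ofReal_ne_zero (h1 : q < 1) : 1 - (q : ℂ) ≠ 0 := by
  rw [sub_ne_zero]
  exact_mod_cast h1.ne'

theorem one_sub_mul_cConst (h0 : 0 < q) (h1 : q < 1) (v : ℂ) : (1 - (q : ℂ)) * cConst q v =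
    qPochInf (((q ^ 2 : ℝ) : ℂ) ^ (v + 1)) (q ^ 2) / qPochInf (q ^ 2 : ℝ) (q ^ 2) := by
  have := one_sub_ofReal_ne_zero h1
  rw [ofReal_sq_cpow h0, cConst, ← mul_assoc, mul_one_div_cancel this, one_mul,
    Complex.ofReal_pow]

theorem cConst_ne_zero (h0 : 0 < q) (h1 : q < 1) {v : ℂ} (hv : -1 < v.re) : cConst q v ≠ 0 := by
  have hp0 : 0 < q ^ 2 := by positivity
  have hp1 : q ^ 2 < 1 := pow_lt_one₀ h0.le h1 two_ne_zero
  refine right_ne_zero_of_mul (a := 1 - (q : ℂ)) ?_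
  rw [one_sub_mul_cConst h0 h1]
  refine div_ne_zero (qPochInf_ne_zero hp0 hp1 ?_)
    (qPochInf_ne_zero hp0 hp1 (norm_ofReal_lt_one hp0 hp1))
  rw [Complex.norm_cpow_eq_rpow_re_of_pos hp0]
  refine Real.rpow_lt_one hp0.le hp1 ?_
  simp only [Complex.add_re, Complex.one_re]
  linarith

theorem cConst_zero (h0 : 0 < q) (h1 : q < 1) : cConst q 0 = (1 - (q : ℂ))⁻¹ := by
  have hp0 : 0 < q ^ 2 := by positivity
  have hp1 : q ^ 2 < 1 := pow_lt_one₀ h0.le h1 two_ne_zero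
  have h := one_sub_mul_cConst h0 h1 0
  rw [zero_add, Complex.cpow_one,
    div_self (qPochInf_ne_zero hp0 hp1 (norm_ofReal_lt_one hp0 hp1))] at h
  exact eq_inv_of_mul_eq_one_right h

theorem jNorm_zpow (h0 : 0 < q) (h1 : q < 1) {v : ℂ} (hv : -1 < v.re) (n : ℤ) :
    jNorm (q ^ 2) v ((q : ℂ) ^ n) =
      besselZ (q ^ 2) n ((q : ℂ) ^ v) / ((1 - q) * cConst q v * ((q : ℂ) ^ v) ^ n) := by
  have hp0 : 0 < q ^ 2 := by positivity
  have hp1 : q ^ 2 < 1 := pow_lt_one₀ h0.le h1 two_ne_zero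
  have h := besselJ_eq hp0 hp1 hv ((q : ℂ) ^ n)
  rw [besselJ_zpow h0 h1, ← one_sub_mul_cConst h0 h1, zpow_cpow h0] at h
  rw [h, mul_div_cancel_left₀]
  exact mul_ne_zero (mul_ne_zero (one_sub_ofReal_ne_zero h1) (cConst_ne_zero h0 h1 hv))
    (zpow_ne_zero _ (cpow_ofReal_ne_zero h0 v))

theorem jNorm_zpow_mul (h0 : 0 < q) (h1 : q < 1) {v : ℂ} (hv : -1 < v.re) (m n : ℤ) :
    jNorm (q ^ 2) v ((q ^ m * q ^ n : ℝ) : ℂ) =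
      besselZ (q ^ 2) (m + n) ((q : ℂ) ^ v) /
        ((1 - q) * cConst q v * (((q : ℂ) ^ v) ^ m * ((q : ℂ) ^ v) ^ n)) := by
  rw [← zpow_add₀ h0.ne', Complex.ofReal_zpow, jNorm_zpow h0 h1 hv,
    zpow_add₀ (cpow_ofReal_ne_zero h0 v)]

/-- The factor of order z - k is already of integer order; the symmetry is needed only for the
factor of order v + z - k. The powers of q are regrouped as m-th, z-th and k-th powers. -/
theorem kernelE_eq (h0 : 0 < q) (h1 : q < 1) (v x : ℂ) (m z k : ℤ) :
    kernelE q v x (q ^ m) (q ^ z) (q ^ k) =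
      pairK q ((q : ℂ) ^ v) ((q : ℂ) ^ (x - v)) (m - k, z - k) /
        (((1 - q) * cConst q v) * ((1 - q) * cConst q (x - v)) *
          (((q : ℂ) ^ v) ^ m * ((q : ℂ) ^ (x - v)) ^ z) *
          ((q ^ 2 : ℝ) * ((q : ℂ) ^ v * (q : ℂ) ^ (x - v))) ^ k) := by
  have hq := ofReal_ne_zero_of_pos h0
  have hp0 : 0 < q ^ 2 := by positivity
  have hp1 : q ^ 2 < 1 := pow_lt_one₀ h0.le h1 two_ne_zero
  rw [kernelE_zpow h0 h1]
  have e1 : besselJ (q ^ 2) ((z : ℂ) - k) ((q : ℂ) ^ (x - v + m - k)) =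
      besselZ (q ^ 2) (z - k) ((q : ℂ) ^ (x - v) * (q : ℂ) ^ (m - k)) := by
    rw [← Int.cast_sub, besselJ_intCast hp0 hp1 _ (cpow_ofReal_ne_zero h0 _), add_sub_assoc,
      Complex.cpow_add _ _ hq, ← Int.cast_sub, Complex.cpow_intCast]
  have e2 : besselJ (q ^ 2) (v + z - k) ((q : ℂ) ^ (m - k)) =
      besselZ (q ^ 2) (m - k) ((q : ℂ) ^ v * (q : ℂ) ^ (z - k)) := by
    rw [besselJ_zpow h0 h1, add_sub_assoc, Complex.cpow_add _ _ hq, ← Int.cast_sub,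
      Complex.cpow_intCast]
  have e3 : (q : ℂ) ^ (-(k : ℂ) * (x + 2) - m * v - z * (x - v)) =
      ((((q : ℂ) ^ v) ^ m * ((q : ℂ) ^ (x - v)) ^ z) *
          ((q ^ 2 : ℝ) * ((q : ℂ) ^ v * (q : ℂ) ^ (x - v))) ^ k)⁻¹ := by
    rw [← Complex.cpow_add _ _ hq, ← Complex.cpow_mul_int, ← Complex.cpow_mul_int,
      show ((q ^ 2 : ℝ) : ℂ) = (q : ℂ) ^ (2 : ℂ) by simp, ← Complex.cpow_add _ _ hq,
      ← Complex.cpow_add _ _ hq, ← Complex.cpow_mul_int, ← Complex.cpow_add _ _ hq,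
      ← Complex.cpow_neg]
    congr 1
    ring
  rw [e1, e2, e3, pairK]
  generalize 1 - (q : ℂ) = d
  ring

theorem qIntegral_of_hasSum {f : ℝ → ℂ} {S : ℂ} (h : HasSum (fun n : ℤ => q ^ n • f (q ^ n)) S) :
    QIntegrable q f ∧ qIntegral q f = (1 - q) * S := by
  refine ⟨h.summable, ?_⟩
  rw [qIntegral, h.tsum_eq, Complex.real_smul]
  push_cast
  rfl

theorem norm_cpow_lt_inv (h0 : 0 < q) (h1 : q < 1) {x : ℂ} (hx : -1 < x.re) :
    ‖(q : ℂ) ^ x‖ < q⁻¹ := by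
  rw [Complex.norm_cpow_eq_rpow_re_of_pos h0, ← Real.rpow_neg_one]
  exact Real.rpow_lt_rpow_of_exponent_gt h0 h1 hx

theorem cpow_mul_cpow_sub (h0 : 0 < q) (v x : ℂ) : (q : ℂ) ^ v * (q : ℂ) ^ (x - v) = (q : ℂ) ^ x := by
  rw [← Complex.cpow_add _ _ (ofReal_ne_zero_of_pos h0), add_sub_cancel]

theorem smul_mul_weight (h0 : 0 < q) (x w : ℂ) (n : ℤ) :
    q ^ n • (w * ((q ^ n : ℝ) : ℂ) ^ (2 * x + 1)) =
      w * (((q ^ 2 : ℝ) : ℂ) ^ n * (((q : ℂ) ^ x) ^ n) ^ 2) := by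
  have hq := ofReal_ne_zero_of_pos h0
  have hqn : (q : ℂ) ^ n ≠ 0 := zpow_ne_zero _ hq
  rw [Complex.real_smul, Complex.ofReal_zpow, Complex.cpow_add _ _ hqn, Complex.cpow_one,
    zpow_cpow h0, mul_comm 2 x, Complex.ofReal_pow]
  have : (q : ℂ) ^ (x * 2) = ((q : ℂ) ^ x) ^ 2 := by
    rw [← Complex.cpow_mul_nat]
    norm_num
  rw [this, sq (q : ℂ), mul_zpow, sq, mul_zpow]
  ring

/-- The product formula for the normalized Hahn-Exton functions. -/
theorem product_formula (h0 : 0 < q) (h1 : q < 1) (m z : ℤ) {v x : ℂ} (hv : -1 < v.re)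
    (hxv : -1 < (x - v).re) (hx : -1 < x.re) (n : ℤ) :
    QIntegrable q (fun t => kernelE q v x (q ^ m) (q ^ z) t *
        jNorm (q ^ 2) x ((q ^ n * t : ℝ) : ℂ) * (t : ℂ) ^ (2 * x + 1)) ∧
      jNorm (q ^ 2) v ((q ^ m * q ^ n : ℝ) : ℂ) * jNorm (q ^ 2) (x - v) ((q ^ z * q ^ n : ℝ) : ℂ) =
        besselTransform q x (kernelE q v x (q ^ m) (q ^ z)) (q ^ n) := by
  have hab := cpow_mul_cpow_sub h0 v x
  have ha := cpow_ofReal_ne_zero h0 v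
  have hb := cpow_ofReal_ne_zero h0 (x - v)
  have hd := one_sub_ofReal_ne_zero h1
  have hc1 := cConst_ne_zero h0 h1 hv
  have hc2 := cConst_ne_zero h0 h1 hxv
  have hc3 := cConst_ne_zero h0 h1 hx
  have hp := ofReal_ne_zero_of_pos (show 0 < q ^ 2 by positivity)
  -- The point λ = q^n shifts both orders by n; replacing the summation index by k + n leaves the
  -- kernel at (m - k, z - k).
  have key := ((Equiv.addRight n).hasSum_iff.2 (product_formulas h0 h1 ha hb
    (by rw [hab]; exact norm_cpow_lt_inv h0 h1 hx) (m + n) (z + n)).1).div_const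
    (((1 - q) * cConst q v) * ((1 - q) * cConst q (x - v)) * ((1 - q) * cConst q x) *
      ((((q : ℂ) ^ v) ^ m * ((q : ℂ) ^ (x - v)) ^ z) * ((q : ℂ) ^ v * (q : ℂ) ^ (x - v)) ^ n))
  have h := qIntegral_of_hasSum (q := q) (f := fun t => kernelE q v x (q ^ m) (q ^ z) t *
        jNorm (q ^ 2) x ((q ^ n * t : ℝ) : ℂ) * (t : ℂ) ^ (2 * x + 1))
    (HasSum.of_eq key (fun k => ?_) rfl)
  · refine ⟨h.1, ?_⟩
    rw [besselTransform, h.2, jNorm_zpow_mul h0 h1 hv, jNorm_zpow_mul h0 h1 hxv, mul_zpow]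
    field_simp
  · rw [smul_mul_weight h0, kernelE_eq h0 h1, jNorm_zpow_mul h0 h1 hx, ← hab]
    simp only [Function.comp, Equiv.coe_addRight, mul_zpow, add_sub_add_right_eq_sub]
    rw [add_comm n k]
    field_simp

theorem inverse_product_formula (h0 : 0 < q) (h1 : q < 1) (m z : ℤ) {v x : ℂ} (hv : -1 < v.re)
    (hxv : -1 < (x - v).re) (hx : -1 < x.re) (k : ℤ) :
    QIntegrable q (fun l => jNorm (q ^ 2) v ((q ^ m * l : ℝ) : ℂ) *
        jNorm (q ^ 2) (x - v) ((q ^ z * l : ℝ) : ℂ) * jNorm (q ^ 2) x ((q ^ k * l : ℝ) : ℂ) *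
          (l : ℂ) ^ (2 * x + 1)) ∧
      kernelE q v x (q ^ m) (q ^ z) (q ^ k) = cConst q x * qIntegral q (fun l =>
        jNorm (q ^ 2) v ((q ^ m * l : ℝ) : ℂ) *
        jNorm (q ^ 2) (x - v) ((q ^ z * l : ℝ) : ℂ) * jNorm (q ^ 2) x ((q ^ k * l : ℝ) : ℂ) *
          (l : ℂ) ^ (2 * x + 1)) := by
  have hab := cpow_mul_cpow_sub h0 v x
  have ha := cpow_ofReal_ne_zero h0 v
  have hb := cpow_ofReal_ne_zero h0 (x - v)
  have hd := one_sub_ofReal_ne_zero h1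
  have hc1 := cConst_ne_zero h0 h1 hv
  have hc2 := cConst_ne_zero h0 h1 hxv
  have hc3 := cConst_ne_zero h0 h1 hx
  have hp := ofReal_ne_zero_of_pos (show 0 < q ^ 2 by positivity)
  -- Taken at (m - k, z - k) with index n + k, so that the three orders become m + n, z + n and k +
  -- n.
  have key := ((Equiv.addRight k).hasSum_iff.2 (product_formulas h0 h1 ha hb
    (by rw [hab]; exact norm_cpow_lt_inv h0 h1 hx) (m - k) (z - k)).2).div_const
    (((1 - q) * cConst q v) * ((1 - q) * cConst q (x - v)) * ((1 - q) * cConst q x) *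
      ((((q : ℂ) ^ v) ^ m * ((q : ℂ) ^ (x - v)) ^ z) *
        ((q ^ 2 : ℝ) * ((q : ℂ) ^ v * (q : ℂ) ^ (x - v))) ^ k))
  have h := qIntegral_of_hasSum (q := q) (f := fun l => jNorm (q ^ 2) v ((q ^ m * l : ℝ) : ℂ) *
        jNorm (q ^ 2) (x - v) ((q ^ z * l : ℝ) : ℂ) * jNorm (q ^ 2) x ((q ^ k * l : ℝ) : ℂ) *
          (l : ℂ) ^ (2 * x + 1))
    (HasSum.of_eq key (fun n => ?_) rfl)
  · refine ⟨h.1, ?_⟩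
    rw [h.2, kernelE_eq h0 h1]
    field_simp
  · rw [smul_mul_weight h0, jNorm_zpow_mul h0 h1 hv, jNorm_zpow_mul h0 h1 hxv,
      jNorm_zpow_mul h0 h1 hx, ← hab]
    simp only [Function.comp, Equiv.coe_addRight, mul_zpow, zpow_add₀ hp]
    rw [add_comm k n, show m - k + (n + k) = m + n by ring, show z - k + (n + k) = z + n by ring]
    field_simp

end Bridge

/-! ### Order zero: the kernel as a square, and positivity of the translation. -/

section OrderZero

variable {q : ℝ}

theorem besselZ_ofReal (p : ℝ) (n : ℤ) (x : ℝ) : ∃ r : ℝ, besselZ p n x = r := by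
  have h1 : ∀ n, ∃ r : ℝ, qPoch p p n = r := fun n =>
    ⟨∏ i ∈ Finset.range n, (1 - p * p ^ i), by simp [qPoch]⟩
  have h2 : ∀ n, ∃ r : ℝ, invFact p n = r := fun n => by
    unfold invFact
    split_ifs
    · obtain ⟨r, hr⟩ := h1 n.toNat
      exact ⟨r⁻¹, by rw [hr, Complex.ofReal_inv]⟩
    · exact ⟨0, by simp⟩
  choose f hf using h1
  choose g hg using h2
  refine ⟨∑' l : ℕ, (-1) ^ l * p ^ (l * (l + 1) / 2) * (f l)⁻¹ * g (n + l) *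
    x ^ (n + 2 * l : ℤ), ?_⟩
  rw [besselZ, Complex.ofReal_tsum]
  refine tsum_congr fun l => ?_
  rw [besselTerm, hf, hg]
  push_cast
  rfl

/-- For a = b = 1 the factors are J_m(q^z) and J_z(q^m), equal by the symmetry. This is the source
of positivity. -/
theorem pairK_one_one (h0 : 0 < q) (h1 : q < 1) (m z : ℤ) :
    pairK q 1 1 (m, z) = besselZ (q ^ 2) z ((q : ℂ) ^ m) ^ 2 := by
  have hp0 : 0 < q ^ 2 := by positivity
  have hp1 : q ^ 2 < 1 := pow_lt_one₀ h0.le h1 two_ne_zero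
  have hq := ofReal_ne_zero_of_pos h0
  have e : besselZ (q ^ 2) z ((q : ℂ) ^ m) = besselZ (q ^ 2) m ((q : ℂ) ^ z) := by
    rw [← besselJ_intCast hp0 hp1 z (zpow_ne_zero _ hq), besselJ_zpow h0 h1, Complex.cpow_intCast]
  simp only [pairK, one_mul]
  rw [← e, sq (besselZ _ _ _)]

theorem pairK_one_one_nonneg (h0 : 0 < q) (h1 : q < 1) (m z : ℤ) :
    ∃ r : ℝ, 0 ≤ r ∧ pairK q 1 1 (m, z) = r := by
  obtain ⟨r, hr⟩ := besselZ_ofReal (q ^ 2) z (q ^ m)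
  refine ⟨r ^ 2, sq_nonneg r, ?_⟩
  rw [pairK_one_one h0 h1, ← Complex.ofReal_zpow, hr, Complex.ofReal_pow]

theorem jNorm_zero_zpow_mul (h0 : 0 < q) (h1 : q < 1) (m n : ℤ) :
    jNorm (q ^ 2) 0 ((q ^ m * q ^ n : ℝ) : ℂ) = besselZ (q ^ 2) (m + n) 1 := by
  rw [jNorm_zpow_mul h0 h1 (by simp), cConst_zero h0 h1,
    mul_inv_cancel₀ (one_sub_ofReal_ne_zero h1)]
  simp

theorem kernelD_zero (h0 : 0 < q) (h1 : q < 1) (m z k : ℤ) :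
    kernelD q 0 (q ^ m) (q ^ z) (q ^ k) =
      (1 - (q : ℂ))⁻¹ * (q : ℂ) ^ (-2 * k) * pairK q 1 1 (m - k, z - k) := by
  have h := (inverse_product_formula h0 h1 m z (v := 0) (x := 0) (by simp) (by simp) (by simp)
    k).2
  rw [sub_zero] at h
  rw [kernelD, sq, mul_assoc, ← h, kernelE_eq h0 h1, sub_zero, Complex.cpow_zero,
    cConst_zero h0 h1, mul_inv_cancel₀ (one_sub_ofReal_ne_zero h1)]
  have e : (q : ℂ) ^ (-2 * k) = (((q ^ 2 : ℝ) : ℂ) ^ k)⁻¹ := by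
    rw [neg_mul, zpow_neg, zpow_mul]
    norm_cast
  rw [e]
  simp only [one_zpow, mul_one, one_mul]
  ring

/-- At x = 1 the power x^(n+2l) disappears and the reciprocal factorials are bounded, so one
majorant serves all n. -/
theorem exists_norm_besselZ_one_le (h0 : 0 < q) (h1 : q < 1) :
    ∃ C : ℝ, 0 ≤ C ∧ ∀ n, ‖besselZ (q ^ 2) n 1‖ ≤ C := by
  have hp0 : 0 < q ^ 2 := by positivity
  have hp1 : q ^ 2 < 1 := pow_lt_one₀ h0.le h1 two_ne_zero
  obtain ⟨C, hC, h⟩ := exists_norm_invFact_le hp0 hp1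
  have hs := (summable_triangle hp0 hp1 1).norm.mul_left (C * C)
  have key : ∀ n, ‖besselZ (q ^ 2) n 1‖ ≤
      ∑' l : ℕ, C * C * ‖((q ^ 2 : ℝ) : ℂ) ^ (l * (l + 1) / 2) * 1 ^ l‖ := fun n => by
    refine tsum_of_norm_bounded hs.hasSum fun l => ?_
    rw [besselTerm, one_zpow, one_pow, mul_one, mul_one, mul_assoc, mul_assoc, norm_mul, norm_pow,
      norm_neg, norm_one, one_pow, one_mul, norm_mul, norm_mul _ (invFact _ _), mul_comm]
    gcongr
    · rw [← invFact_natCast]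
      exact h _
    · exact h _
  exact ⟨_, (norm_nonneg _).trans (key 0), key⟩

/-- This is the convergence of the generating function at x = 1, s = q², with the index shifted by
l. -/
theorem summable_besselZ_one (h0 : 0 < q) (h1 : q < 1) (l : ℤ) :
    Summable fun n : ℤ => ((q ^ 2 : ℝ) : ℂ) ^ n * besselZ (q ^ 2) (l + n) 1 := by
  have hp0 : 0 < q ^ 2 := by positivity
  have hp1 : q ^ 2 < 1 := pow_lt_one₀ h0.le h1 two_ne_zero
  have hp := ofReal_ne_zero_of_pos hp0
  have h := (hasSum_generating hp0 hp1 (x := 1) (s := (q ^ 2 : ℝ)) one_ne_zero hp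
    (by rw [one_mul]; exact norm_ofReal_lt_one hp0 hp1)).summable
  have h2 := ((Equiv.addLeft l).summable_iff.2 h).mul_left ((((q ^ 2 : ℝ) : ℂ) ^ l)⁻¹)
  refine h2.congr fun n => ?_
  simp only [Function.comp, Equiv.coe_addLeft, zpow_add₀ hp]
  have := zpow_ne_zero l hp
  field_simp

theorem smul_mul_weight_zero (h0 : 0 < q) (w : ℂ) (n : ℤ) :
    q ^ n • (w * ((q ^ n : ℝ) : ℂ) ^ (2 * (0 : ℂ) + 1)) = w * ((q ^ 2 : ℝ) : ℂ) ^ n := by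
  rw [smul_mul_weight h0, Complex.cpow_zero]
  simp

theorem summable_weight_of_memLOne (h0 : 0 < q) {f : ℝ → ℂ} (hf : MemLOne q 0 f) :
    Summable fun n : ℤ => ‖f (q ^ n) * ((q ^ 2 : ℝ) : ℂ) ^ n‖ := by
  refine hf.congr fun n => ?_
  have hqn : 0 < q ^ n := by positivity
  beta_reduce
  rw [norm_mul, norm_zpow, Complex.norm_real, Real.norm_of_nonneg (by positivity), smul_eq_mul,
    mul_zero, zero_add, Real.rpow_one, sq, mul_zpow]
  ring

theorem hasSum_besselTransform_zero (h0 : 0 < q) (h1 : q < 1) {f : ℝ → ℂ} (hf : MemLOne q 0 f)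
    (i : ℤ) :
    QIntegrable q (fun t => f t * jNorm (q ^ 2) 0 ((q ^ i * t : ℝ) : ℂ) *
        (t : ℂ) ^ (2 * (0 : ℂ) + 1)) ∧
      HasSum (fun k : ℤ => f (q ^ k) * ((q ^ 2 : ℝ) : ℂ) ^ k * besselZ (q ^ 2) (i + k) 1)
        (besselTransform q 0 f (q ^ i)) := by
  obtain ⟨C, hC, h⟩ := exists_norm_besselZ_one_le h0 h1
  have hs : Summable fun k : ℤ =>
      f (q ^ k) * ((q ^ 2 : ℝ) : ℂ) ^ k * besselZ (q ^ 2) (i + k) 1 := by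
    refine Summable.of_norm_bounded ((summable_weight_of_memLOne h0 hf).mul_right C) fun k => ?_
    rw [norm_mul]
    gcongr
    exact h _
  have hi := qIntegral_of_hasSum (q := q) (f := fun t => f t *
    jNorm (q ^ 2) 0 ((q ^ i * t : ℝ) : ℂ) * (t : ℂ) ^ (2 * (0 : ℂ) + 1))
    (HasSum.of_eq hs.hasSum (fun k => by
      rw [smul_mul_weight_zero h0, jNorm_zero_zpow_mul h0 h1]
      ring) rfl)
  refine ⟨hi.1, ?_⟩
  rw [besselTransform, hi.2, cConst_zero h0 h1,
    inv_mul_cancel_left₀ (one_sub_ofReal_ne_zero h1)]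
  exact hs.hasSum

theorem summable_translation_zero (h0 : 0 < q) (h1 : q < 1) {f : ℝ → ℂ} (hf : MemLOne q 0 f)
    (i l : ℤ) :
    Summable fun y : ℤ × ℤ => f (q ^ y.2) * ((q ^ 2 : ℝ) : ℂ) ^ y.2 *
      besselZ (q ^ 2) (y.1 + y.2) 1 * (besselZ (q ^ 2) (i + y.1) 1 *
        (((q ^ 2 : ℝ) : ℂ) ^ y.1 * besselZ (q ^ 2) (l + y.1) 1)) := by
  obtain ⟨C, hC, h⟩ := exists_norm_besselZ_one_le h0 h1
  have hs := ((summable_besselZ_one h0 h1 l).norm.mul_of_nonneg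
    (summable_weight_of_memLOne h0 hf) (fun _ => norm_nonneg _) (fun _ => norm_nonneg _)).mul_left
    (C * C)
  refine Summable.of_norm_bounded hs fun y => ?_
  rw [norm_mul, norm_mul _ (besselZ _ (y.1 + y.2) 1), norm_mul (besselZ _ (i + y.1) 1)]
  calc _ ≤ ‖f (q ^ y.2) * ((q ^ 2 : ℝ) : ℂ) ^ y.2‖ * C *
        (C * ‖((q ^ 2 : ℝ) : ℂ) ^ y.1 * besselZ (q ^ 2) (l + y.1) 1‖) := by
        gcongr
        · exact h _
        · exact h _
    _ = _ := by ring

/-- Fubini for one absolutely convergent double series: summing over the argument of f first gives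
the translation, summing over the transform variable first gives the kernel by the inverse product
formula at a = b = 1. -/
theorem hasSum_translation_zero (h0 : 0 < q) (h1 : q < 1) {f : ℝ → ℂ} (hf : MemLOne q 0 f)
    (i l : ℤ) :
    QIntegrable q (fun t => besselTransform q 0 f t * jNorm (q ^ 2) 0 ((q ^ i * t : ℝ) : ℂ) *
        jNorm (q ^ 2) 0 ((q ^ l * t : ℝ) : ℂ) * (t : ℂ) ^ (2 * (0 : ℂ) + 1)) ∧
      HasSum (fun k : ℤ => f (q ^ k) * pairK q 1 1 (i - k, l - k))
        (translation q 0 (q ^ i) f (q ^ l)) := by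
  have hp := ofReal_ne_zero_of_pos (show 0 < q ^ 2 by positivity)
  have hs := summable_translation_zero h0 h1 hf i l
  have hfib : ∀ n : ℤ, HasSum (fun k : ℤ => f (q ^ k) * ((q ^ 2 : ℝ) : ℂ) ^ k *
      besselZ (q ^ 2) (n + k) 1 * (besselZ (q ^ 2) (i + n) 1 *
        (((q ^ 2 : ℝ) : ℂ) ^ n * besselZ (q ^ 2) (l + n) 1)))
      (besselTransform q 0 f (q ^ n) * (besselZ (q ^ 2) (i + n) 1 *
        (((q ^ 2 : ℝ) : ℂ) ^ n * besselZ (q ^ 2) (l + n) 1))) := fun n =>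
    (hasSum_besselTransform_zero h0 h1 hf n).2.mul_right _
  have h1sum := hs.hasSum.prod_fiberwise hfib
  have hi := qIntegral_of_hasSum (q := q) (f := fun t => besselTransform q 0 f t *
    jNorm (q ^ 2) 0 ((q ^ i * t : ℝ) : ℂ) * jNorm (q ^ 2) 0 ((q ^ l * t : ℝ) : ℂ) *
      (t : ℂ) ^ (2 * (0 : ℂ) + 1))
    (HasSum.of_eq h1sum (fun n => by
      rw [smul_mul_weight_zero h0, jNorm_zero_zpow_mul h0 h1, jNorm_zero_zpow_mul h0 h1]
      ring) rfl)
  refine ⟨hi.1, ?_⟩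
  rw [translation, hi.2, cConst_zero h0 h1, inv_mul_cancel_left₀ (one_sub_ofReal_ne_zero h1)]
  have hswap := (Equiv.prodComm ℤ ℤ).hasSum_iff.2 hs.hasSum
  refine hswap.prod_fiberwise fun k => ?_
  have hk := ((Equiv.addRight k).hasSum_iff.2 (product_formulas h0 h1 (one_ne_zero (α := ℂ))
    (one_ne_zero (α := ℂ)) (by simpa using (one_lt_inv₀ h0).2 h1) (i - k) (l - k)).2).mul_left
    (f (q ^ k))
  refine HasSum.of_eq hk (fun n => ?_) rfl
  simp only [Function.comp, Equiv.prodComm_apply, Prod.swap_prod_mk, Equiv.coe_addRight,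
    zpow_add₀ hp, one_mul]
  rw [show i - k + (n + k) = i + n by ring, show l - k + (n + k) = l + n by ring]
  ring

theorem translationPositive_zero (h0 : 0 < q) (h1 : q < 1) {x : ℝ} (hx : x ∈ qReals q) :
    TranslationPositive q 0 x := by
  obtain ⟨i, rfl⟩ := hx
  rintro f hf hpos _ ⟨l, rfl⟩
  rw [Complex.ofReal_zero]
  have h := (hasSum_translation_zero h0 h1 hf i l).2
  have hr : ∀ k : ℤ, ∃ r : ℝ, 0 ≤ r ∧ (f (q ^ k) : ℂ) * pairK q 1 1 (i - k, l - k) = r := by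
    intro k
    obtain ⟨r, hr, e⟩ := pairK_one_one_nonneg h0 h1 (i - k) (l - k)
    exact ⟨f (q ^ k) * r, mul_nonneg (hpos _ ⟨k, rfl⟩) hr, by rw [e, Complex.ofReal_mul]⟩
  choose r hr0 hr using hr
  have h2 := h.tsum_eq
  simp only [hr] at h2
  rw [← Complex.ofReal_tsum] at h2
  dsimp only
  rw [← h2, Complex.ofReal_im, Complex.ofReal_re]
  exact ⟨rfl, tsum_nonneg hr0⟩

end OrderZero

end HahnExton
theorem proposition2 :
    -- the product formula and its inverse
    (∀ q : ℝ, 0 < q → q < 1 → ∀ (m z : ℤ) (v x : ℂ),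
      -1 < v.re → -1 < (x - v).re → -1 < x.re →
      (∀ l ∈ HahnExton.qReals q,
        HahnExton.QIntegrable q (fun t =>
          HahnExton.kernelE q v x (q ^ m) (q ^ z) t *
            HahnExton.jNorm (q ^ 2) x ((l * t : ℝ) : ℂ) * (t : ℂ) ^ (2 * x + 1)) ∧
        HahnExton.jNorm (q ^ 2) v ((q ^ m * l : ℝ) : ℂ) *
            HahnExton.jNorm (q ^ 2) (x - v) ((q ^ z * l : ℝ) : ℂ) =
          HahnExton.besselTransform q x (HahnExton.kernelE q v x (q ^ m) (q ^ z)) l) ∧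
      (∀ k : ℤ,
        HahnExton.QIntegrable q (fun l =>
          HahnExton.jNorm (q ^ 2) v ((q ^ m * l : ℝ) : ℂ) *
            HahnExton.jNorm (q ^ 2) (x - v) ((q ^ z * l : ℝ) : ℂ) *
            HahnExton.jNorm (q ^ 2) x ((q ^ k * l : ℝ) : ℂ) * (l : ℂ) ^ (2 * x + 1)) ∧
        HahnExton.kernelE q v x (q ^ m) (q ^ z) (q ^ k) =
          HahnExton.cConst q x * HahnExton.qIntegral q (fun l =>
            HahnExton.jNorm (q ^ 2) v ((q ^ m * l : ℝ) : ℂ) *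
              HahnExton.jNorm (q ^ 2) (x - v) ((q ^ z * l : ℝ) : ℂ) *
              HahnExton.jNorm (q ^ 2) x ((q ^ k * l : ℝ) : ℂ) * (l : ℂ) ^ (2 * x + 1)))) ∧
    -- the kernel of order zero
    (∀ q : ℝ, 0 < q → q < 1 → ∀ m z k : ℤ,
      HahnExton.kernelD q 0 (q ^ m) (q ^ z) (q ^ k) =
          (1 - (q : ℂ))⁻¹ * (q : ℂ) ^ (-2 * k) *
            HahnExton.besselJ (q ^ 2) ((z : ℂ) - k) ((q : ℂ) ^ (m - k)) ^ 2 ∧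
      (HahnExton.kernelD q 0 (q ^ m) (q ^ z) (q ^ k)).im = 0 ∧
      0 ≤ (HahnExton.kernelD q 0 (q ^ m) (q ^ z) (q ^ k)).re) ∧
    -- the translation operators of order zero are well defined on `L_{q,1,0}`
    (∀ q : ℝ, 0 < q → q < 1 → ∀ f : ℝ → ℂ, HahnExton.MemLOne q 0 f →
      ∀ x ∈ HahnExton.qReals q, ∀ y ∈ HahnExton.qReals q,
        HahnExton.QIntegrable q (fun t =>
          f t * HahnExton.jNorm (q ^ 2) 0 ((x * t : ℝ) : ℂ) * (t : ℂ) ^ (2 * (0 : ℂ) + 1)) ∧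
        HahnExton.QIntegrable q (fun t =>
          HahnExton.besselTransform q 0 f t * HahnExton.jNorm (q ^ 2) 0 ((x * t : ℝ) : ℂ) *
            HahnExton.jNorm (q ^ 2) 0 ((y * t : ℝ) : ℂ) * (t : ℂ) ^ (2 * (0 : ℂ) + 1))) ∧
    -- and positive for every `q`
    HahnExton.positivityDomain 0 = Set.Ioo (0 : ℝ) 1 := by
  refine ⟨?_, ?_, ?_, ?_⟩
  · intro q h0 h1 m z v x hv hxv hx
    refine ⟨?_, HahnExton.inverse_product_formula h0 h1 m z hv hxv hx⟩
    rintro _ ⟨n, rfl⟩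
    exact HahnExton.product_formula h0 h1 m z hv hxv hx n
  · intro q h0 h1 m z k
    have hp0 : 0 < q ^ 2 := by positivity
    have hp1 : q ^ 2 < 1 := pow_lt_one₀ h0.le h1 two_ne_zero
    have h := HahnExton.kernelD_zero h0 h1 m z k
    refine ⟨?_, ?_⟩
    · rw [h, HahnExton.pairK_one_one h0 h1, ← Int.cast_sub, HahnExton.besselJ_intCast hp0 hp1 _
        (zpow_ne_zero _ (HahnExton.ofReal_ne_zero_of_pos h0))]
    · obtain ⟨r, hr, e⟩ := HahnExton.pairK_one_one_nonneg h0 h1 (m - k) (z - k)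
      have e2 : HahnExton.kernelD q 0 (q ^ m) (q ^ z) (q ^ k) =
          (((1 - q)⁻¹ * q ^ (-2 * k) * r : ℝ) : ℂ) := by
        rw [h, e]
        push_cast
        rfl
      rw [e2, Complex.ofReal_im, Complex.ofReal_re]
      have : 0 < 1 - q := sub_pos.2 h1
      exact ⟨rfl, by positivity⟩
  · rintro q h0 h1 f hf _ ⟨i, rfl⟩ _ ⟨l, rfl⟩
    exact ⟨(HahnExton.hasSum_besselTransform_zero h0 h1 hf i).1,
      (HahnExton.hasSum_translation_zero h0 h1 hf i l).1⟩
  · ext q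
    exact ⟨fun h => h.1, fun h => ⟨h, fun _ hx =>
      HahnExton.translationPositive_zero h.1 h.2 hx⟩⟩
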